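/- Theorem (Twisted dyadic Littlewood–Paley equivalences). Let $m\ge 1$ and $1<p<\infty$. Let $\mathscr D$ be the collection of standard dyadic cubes $\prod_{j=1}^m[n_j2^{-k},(n_j+1)2^{-k})$ ($k\in\mathbb Z$, $n\in\mathbb Z^m$) in $\mathbb R^m$, and for $I\in\mathscr D$ let $h_I^{\epsilon}$, $\epsilon\in\mathcal E:=\{0,1\}^m\setminus\{0\}$, be the $2^m-1$ standard $L^2$-normalized Haar functions supported on $I=I_1\times\dots\times I_m$, that is $h_I^\epsilon(x)=\prod_{j}h_{I_j}^{\epsilon_j}(x_j)$ with $h_{I_j}^0=|I_j|^{-1/2}\chi_{I_j}$ and $h_{I_j}^1=|I_j|^{-1/2}(\chi_{I_j^{\rm left}}-\chi_{I_j^{\rm right}})$. On $\mathbb R^{2m}=\mathbb R^m\times\mathbb R^m$ put, for $I,J\in\mathscr D$ and $\vec\epsilon=(\epsilon_1,\epsilon_2)\in\mathcal E\times\mathcal E$, $$h^{(1),\vec\epsilon}_{I,J}(x_1,x_2)=h_I^{\epsilon_1}(x_1)\,h_J^{\epsilon_2}(x_2),\qquad h^{(i),\vec\epsilon}_{I,J}=h^{(1),\vec\epsilon}_{I,J}\circ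 T_i\quad(i=2,3),$$ where $T_2(x_1,x_2)=(x_1-x_2,x_2)$ and $T_3(x_1,x_2)=(x_1,x_2-x_1)$. For $f\in L^p(\mathbb R^{2m})$ (complex-valued) and $i=1,2,3$ define the dyadic square functions $$S_d^{(i)}(f)(\mathbf x)=\Big(\sum_{I,J\in\mathscr D}\ \sum_{\vec\epsilon\in\mathcal E\times\mathcal E}\big|\langle f,h^{(i),\vec\epsilon}_{I,J}\rangle\,h^{(i),\vec\epsilon}_{I,J}(\mathbf x)\big|^2\Big)^{1/2},\qquad \langle f,h\rangle=\int_{\mathbb R^{2m}}f\,h .$$ Then $S_d^{(1)}$, $S_d^{(2)}$ and $S_d^{(3)}$ map $L^p(\mathbb R^{2m})$ boundedly into itself, and there are constants $0<c\le C<\infty$ depending only on $p$ and $m$ such that for every $f\in L^p(\mathbb R^{2m})$ and $i\in\{1,2,3\}$ $$c\,\|f\|_{L^p(\mathbb R^{2m})}\le\big\|S_d^{(i)}(f)\big\|_{L^p(\mathbb R^{2m})}\le C\,\|f\|_{L^p(\mathbb R^{2m})}.$$ -/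

import Mathlib

open MeasureTheory
open scoped ENNReal NNReal

namespace TwistedHaar

/-- The space `ℝ^{2m} = ℝ^m × ℝ^m`; its `volume` is `2m`-dimensional Lebesgue measure. -/
abbrev Space (m : ℕ) : Type := (Fin m → ℝ) × (Fin m → ℝ)

/-- The shear `T₂(x₁, x₂) = (x₁ - x₂, x₂)`. -/
def T₂ {m : ℕ} (x : Space m) : Space m := (x.1 - x.2, x.2)

/-- The shear `T₃(x₁, x₂) = (x₁, x₂ - x₁)`. -/
def T₃ {m : ℕ} (x : Space m) : Space m := (x.1, x.2 - x.1)

/-- A standard dyadic cube of `ℝ^m`, given by its scale `k` and its position `n`: the cube is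
`∏ j, [n j * 2^(-k), (n j + 1) * 2^(-k))`. -/
structure DyadicCube (m : ℕ) where
  scale : ℤ
  pos : Fin m → ℤ

/-- The set of points of a dyadic cube. -/
def DyadicCube.toSet {m : ℕ} (I : DyadicCube m) : Set (Fin m → ℝ) :=
  {x | ∀ j, x j ∈ Set.Ico ((I.pos j : ℝ) * 2 ^ (-I.scale)) (((I.pos j : ℝ) + 1) * 2 ^ (-I.scale))}

/-- The `L²`-normalized one-dimensional functions attached to the dyadic interval
`[n 2^(-k), (n+1) 2^(-k))`: for `e = false` the normalized indicator function of the interval, for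
`e = true` the Haar function (positive on the left half, negative on the right half). -/
noncomputable def haarOne (k n : ℤ) (e : Bool) (t : ℝ) : ℝ :=
  Real.sqrt ((2 : ℝ) ^ k) *
    (Set.indicator (Set.Ico ((n : ℝ) * 2 ^ (-k)) (((n : ℝ) + 1 / 2) * 2 ^ (-k))) 1 t +
      (if e then -1 else 1) *
        Set.indicator (Set.Ico (((n : ℝ) + 1 / 2) * 2 ^ (-k)) (((n : ℝ) + 1) * 2 ^ (-k))) 1 t)

/-- The index set of the Haar functions on one cube: the `2^m - 1` nonzero elements of
`{0, 1}^m`. -/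
abbrev Sign (m : ℕ) : Type := {e : Fin m → Bool // ∃ j, e j = true}

/-- The standard `L²`-normalized Haar function `h_I^ε` on `ℝ^m`. -/
noncomputable def haarCube {m : ℕ} (I : DyadicCube m) (e : Sign m) (x : Fin m → ℝ) : ℝ :=
  ∏ j, haarOne I.scale (I.pos j) (e.1 j) (x j)

theorem support_haarOne (k n : ℤ) (e : Bool) :
    Function.support (haarOne k n e) =
      Set.Ico ((n : ℝ) * 2 ^ (-k)) (((n : ℝ) + 1) * 2 ^ (-k)) := by
  have h2 : (0 : ℝ) < 2 ^ (-k) := by positivity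
  have hs : Real.sqrt ((2 : ℝ) ^ k) ≠ 0 := by positivity
  ext t
  simp only [Function.mem_support, haarOne, Set.indicator_apply, Set.mem_Ico, Pi.one_apply,
    ne_eq, mul_eq_zero, hs, false_or]
  have h3 : ((n : ℝ) + 1 / 2) * 2 ^ (-k) = n * 2 ^ (-k) + 2 ^ (-k) / 2 := by ring
  have h4 : ((n : ℝ) + 1) * 2 ^ (-k) = n * 2 ^ (-k) + 2 ^ (-k) := by ring
  rw [h3, h4]
  generalize (n : ℝ) * 2 ^ (-k) = a
  generalize (2 : ℝ) ^ (-k) = d at h2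
  cases e <;> split_ifs <;> grind

/-- The Haar functions of a dyadic cube are supported exactly on that cube. -/
theorem support_haarCube {m : ℕ} (I : DyadicCube m) (e : Sign m) :
    Function.support (haarCube I e) = I.toSet := by
  ext x
  simp only [Function.mem_support, haarCube, ne_eq, Finset.prod_eq_zero_iff, Finset.mem_univ,
    true_and, not_exists, DyadicCube.toSet, Set.mem_ofPred_eq]
  refine forall_congr' fun j => ?_
  rw [← support_haarOne I.scale (I.pos j) (e.1 j), Function.mem_support]

/-- Indices `((I, J), (ε₁, ε₂))` of the three Haar systems on `ℝ^{2m}`. -/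
abbrev Index (m : ℕ) : Type := (DyadicCube m × DyadicCube m) × (Sign m × Sign m)

/-- The tensor product Haar system `B₁`: `h_{I×J}^ε(x₁, x₂) = h_I^{ε₁}(x₁) h_J^{ε₂}(x₂)`. -/
noncomputable def B₁ {m : ℕ} (r : Index m) (x : Space m) : ℝ :=
  haarCube r.1.1 r.2.1 x.1 * haarCube r.1.2 r.2.2 x.2

/-- The twisted Haar system `B₂`, the pullback of `B₁` through `T₂`. -/
noncomputable def B₂ {m : ℕ} (r : Index m) (x : Space m) : ℝ := B₁ r (T₂ x)

/-- The twisted Haar system `B₃`, the pullback of `B₁` through `T₃`. -/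
noncomputable def B₃ {m : ℕ} (r : Index m) (x : Space m) : ℝ := B₁ r (T₃ x)

/-- The dyadic square function
`(∑_R ∑_ε |⟨f, h_R^ε⟩ h_R^ε(x)|²)^{1/2}` of a system `h` of real functions, as an element of
`[0, ∞]`. -/
noncomputable def squareFunction {m : ℕ} (h : Index m → Space m → ℝ) (f : Space m → ℂ)
    (x : Space m) : ℝ≥0∞ :=
  (∑' r : Index m, ‖(∫ y, f y * (h r y : ℂ)) * (h r x : ℂ)‖ₑ ^ 2) ^ (1 / 2 : ℝ)

/-- The square functions `S_d^{(1)}`, `S_d^{(2)}`, `S_d^{(3)}` of the systems `B₁`, `B₂`, `B₃`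
(numbered here by `0, 1, 2 : Fin 3`). -/
noncomputable def S_d {m : ℕ} (i : Fin 3) (f : Space m → ℂ) : Space m → ℝ≥0∞ :=
  match i with
  | 0 => squareFunction B₁ f
  | 1 => squareFunction B₂ f
  | 2 => squareFunction B₃ f

end TwistedHaar

namespace TwistedHaar

/-! ### Dyadic cubes -/

/-! The shears preserve Lebesgue measure, and pulling the system back by a shear turns the square
function of `f` into that of `f` composed with the inverse shear, evaluated at the sheared point
(`squareFunction_comp`). So everything reduces to the untwisted product system `B₁`.

Upper bound. The core is a one-parameter dyadic square function estimate for functions with values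
in an inner product space. Haar coefficients over a cube are controlled by `osc`, the mean square
oscillation of the averages over its children, so the square function is dominated by the
conditional square function of the dyadic martingale. The latter is bounded by the Bellman method: a
function of the current cube, the accumulated square sum `A` and the running maximum `L` of the
averages of `‖F‖` majorises `A ^ (p / 2)` times the volume and does not increase when summed over
the children. For `p ≥ 2` convexity of the power suffices. For `p ≤ 2` the weight `L ^ (p - 2)`
linearises the concave power, and a Doob-type term pays for the running maximum. The Hilbert-valued
form allows iteration: the scalar estimate in the second variable yields a vector of Haar terms, to
which the vector estimate in the first variable applies (`lintegral_B₁_sum_le`). Constants do not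
depend on the finite index set, so monotone convergence gives the full sum.

Lower bound. By orthonormality, the pairing of `f` with a finite Haar combination `g` is at most the
integral of the product of their square functions. Hölder's inequality and the upper bound at the
conjugate exponent, density of Haar combinations in that space, and the extremal choice of `g` give
the converse inequality (`eLpNorm_le_squareFunction_B₁`). Density holds because the indicator of a
cube is, modulo Haar functions, a small multiple of the indicator of a distant ancestor, whose norm
tends to zero when the exponent exceeds one. -/

theorem DyadicCube.ext_iff' {m : ℕ} {I J : DyadicCube m} :
    I = J ↔ I.scale = J.scale ∧ ∀ j, I.pos j = J.pos j := by
  cases I; cases J; simp [funext_iff]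

instance countable_dyadicCube {m : ℕ} : Countable (DyadicCube m) :=
  Function.Injective.countable (f := fun I : DyadicCube m => (I.scale, I.pos)) fun I J h => by
    cases I; cases J; simpa using h

/-- The dyadic cube of scale `k` that contains `x`. -/
noncomputable def cubeAt {m : ℕ} (k : ℤ) (x : Fin m → ℝ) : DyadicCube m :=
  ⟨k, fun j => ⌊x j * 2 ^ k⌋⟩

theorem mem_Ico_dyadic_iff {k n : ℤ} {t : ℝ} :
    t ∈ Set.Ico ((n : ℝ) * 2 ^ (-k)) (((n : ℝ) + 1) * 2 ^ (-k)) ↔ ⌊t * 2 ^ k⌋ = n := by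
  have h : (0 : ℝ) < 2 ^ k := by positivity
  rw [Int.floor_eq_iff, Set.mem_Ico, zpow_neg, ← div_eq_mul_inv, ← div_eq_mul_inv, div_le_iff₀ h,
    lt_div_iff₀ h]

/-- Membership becomes an equation between integer floors, so nesting and disjointness of dyadic
cubes reduce to integer arithmetic. -/
theorem mem_toSet_iff {m : ℕ} {I : DyadicCube m} {x : Fin m → ℝ} :
    x ∈ I.toSet ↔ cubeAt I.scale x = I := by
  simp only [DyadicCube.toSet, Set.mem_ofPred_eq, DyadicCube.ext_iff', cubeAt, true_and]
  exact forall_congr' fun j => mem_Ico_dyadic_iff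

theorem mem_cubeAt {m : ℕ} (k : ℤ) (x : Fin m → ℝ) : x ∈ (cubeAt k x).toSet :=
  mem_toSet_iff.2 rfl

theorem toSet_eq_pi {m : ℕ} (I : DyadicCube m) :
    I.toSet = Set.univ.pi fun j =>
      Set.Ico ((I.pos j : ℝ) * 2 ^ (-I.scale)) (((I.pos j : ℝ) + 1) * 2 ^ (-I.scale)) := by
  ext x; simp [DyadicCube.toSet, Set.mem_pi]

theorem measurableSet_toSet {m : ℕ} (I : DyadicCube m) : MeasurableSet I.toSet := by
  rw [toSet_eq_pi]
  exact MeasurableSet.univ_pi fun j => measurableSet_Ico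

theorem volume_toSet {m : ℕ} (I : DyadicCube m) :
    volume I.toSet = ENNReal.ofReal (((2 : ℝ) ^ (-I.scale)) ^ m) := by
  rw [toSet_eq_pi, Real.volume_pi_Ico]
  simp only [add_mul, one_mul, add_sub_cancel_left, Finset.prod_const, Finset.card_univ,
    Fintype.card_fin]
  rw [ENNReal.ofReal_pow (by positivity)]

/-- The volume of a dyadic cube as a real number. -/
noncomputable def DyadicCube.vol {m : ℕ} (I : DyadicCube m) : ℝ := ((2 : ℝ) ^ (-I.scale)) ^ m

theorem vol_pos {m : ℕ} (I : DyadicCube m) : 0 < I.vol := by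
  unfold DyadicCube.vol; positivity

theorem volume_toSet_ne_top {m : ℕ} (I : DyadicCube m) : volume I.toSet ≠ ∞ := by
  rw [volume_toSet]; exact ENNReal.ofReal_ne_top

theorem measureReal_toSet {m : ℕ} (I : DyadicCube m) : volume.real I.toSet = I.vol := by
  rw [Measure.real, volume_toSet, ENNReal.toReal_ofReal (by positivity)]; rfl

/-- The `2^m` dyadic children of a cube. -/
def DyadicCube.child {m : ℕ} (I : DyadicCube m) (c : Fin m → Bool) : DyadicCube m :=
  ⟨I.scale + 1, fun j => 2 * I.pos j + (if c j then 1 else 0)⟩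

theorem floor_mul_zpow (t : ℝ) (k : ℤ) : ⌊t * 2 ^ k⌋ = ⌊t * 2 ^ (k + 1)⌋ / 2 := by
  have : t * 2 ^ k = t * 2 ^ (k + 1) / (2 : ℕ) := by
    rw [zpow_add₀ two_ne_zero]; push_cast; ring
  rw [this, Int.floor_div_natCast]; rfl

/-- The floor at the next scale has the parent's position as its quotient by 2; its parity tells
which half contains the point in each coordinate. -/
theorem mem_child_iff {m : ℕ} {I : DyadicCube m} {c : Fin m → Bool} {x : Fin m → ℝ} :
    x ∈ (I.child c).toSet ↔
      x ∈ I.toSet ∧ c = fun j => decide (⌊x j * 2 ^ (I.scale + 1)⌋ % 2 = 1) := by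
  simp only [mem_toSet_iff, DyadicCube.ext_iff', DyadicCube.child, cubeAt, true_and, funext_iff,
    ← forall_and]
  refine forall_congr' fun j => ?_
  rw [floor_mul_zpow (x j) I.scale]
  cases c j <;> simp <;> omega

theorem child_toSet_subset {m : ℕ} (I : DyadicCube m) (c : Fin m → Bool) :
    (I.child c).toSet ⊆ I.toSet := fun _ hx => (mem_child_iff.1 hx).1

theorem iUnion_child {m : ℕ} (I : DyadicCube m) : I.toSet = ⋃ c, (I.child c).toSet := by
  ext x
  simp [mem_child_iff]

theorem pairwise_disjoint_child {m : ℕ} (I : DyadicCube m) :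
    Pairwise (Function.onFun Disjoint fun c => (I.child c).toSet) := fun _ _ h =>
  Set.disjoint_left.2 fun _ hx hx' =>
    h ((mem_child_iff.1 hx).2.trans (mem_child_iff.1 hx').2.symm)

theorem vol_child {m : ℕ} (I : DyadicCube m) (c : Fin m → Bool) :
    (I.child c).vol = I.vol / 2 ^ m := by
  simp only [DyadicCube.vol, DyadicCube.child]
  rw [neg_add, zpow_add₀ two_ne_zero, mul_pow, zpow_neg_one, inv_pow, div_eq_mul_inv]

/-! ### Averages over dyadic cubes -/

section Average

variable {m : ℕ} {E : Type*} [NormedAddCommGroup E]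

/-- The average of `F` over a dyadic cube. -/
noncomputable def cubeAvg [NormedSpace ℝ E] (F : (Fin m → ℝ) → E) (I : DyadicCube m) : E :=
  ⨍ x in I.toSet, F x

theorem integral_eq_vol_smul_cubeAvg [NormedSpace ℝ E] (F : (Fin m → ℝ) → E) (I : DyadicCube m) :
    ∫ x in I.toSet, F x = I.vol • cubeAvg F I := by
  rw [cubeAvg, setAverage_eq, measureReal_toSet, smul_inv_smul₀ (vol_pos I).ne']

theorem setIntegral_eq_sum_child [NormedSpace ℝ E] {F : (Fin m → ℝ) → E} {I : DyadicCube m}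
    (hF : IntegrableOn F I.toSet) :
    ∫ x in I.toSet, F x = ∑ c, ∫ x in (I.child c).toSet, F x := by
  conv_lhs => rw [iUnion_child I]
  exact integral_iUnion_fintype (fun c => measurableSet_toSet _) (pairwise_disjoint_child I)
    fun c => hF.mono_set (child_toSet_subset I c)

theorem cubeAvg_eq_sum_child [NormedSpace ℝ E] {F : (Fin m → ℝ) → E} {I : DyadicCube m}
    (hF : IntegrableOn F I.toSet) :
    cubeAvg F I = ((2 : ℝ) ^ m)⁻¹ • ∑ c, cubeAvg F (I.child c) := by
  have h := setIntegral_eq_sum_child hF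
  simp only [integral_eq_vol_smul_cubeAvg, vol_child, ← Finset.smul_sum] at h
  rw [← inv_smul_smul₀ (vol_pos I).ne' (cubeAvg F I), h, smul_smul]
  congr 1
  have := (vol_pos I).ne'
  field_simp

theorem norm_cubeAvg_le [NormedSpace ℝ E] (F : (Fin m → ℝ) → E) (I : DyadicCube m) :
    ‖cubeAvg F I‖ ≤ cubeAvg (fun x => ‖F x‖) I := by
  simp only [cubeAvg, setAverage_eq, norm_smul, norm_inv, smul_eq_mul]
  rw [Real.norm_of_nonneg measureReal_nonneg]
  gcongr
  exact norm_integral_le_integral_norm F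

theorem cubeAvg_norm_nonneg (F : (Fin m → ℝ) → E) (I : DyadicCube m) :
    0 ≤ cubeAvg (fun x => ‖F x‖) I :=
  (norm_nonneg _).trans ((norm_cubeAvg_le (fun x => ‖F x‖) I).trans_eq (by simp))

/-- Dyadic regularity: an average of nonnegative terms dominates each term up to their number. It
limits the jumps of the running maximum in the case `p ≤ 2`. -/
theorem cubeAvg_norm_child_le {F : (Fin m → ℝ) → E} {I : DyadicCube m}
    (hF : IntegrableOn F I.toSet) (c : Fin m → Bool) :
    cubeAvg (fun x => ‖F x‖) (I.child c) ≤ 2 ^ m * cubeAvg (fun x => ‖F x‖) I := by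
  rw [cubeAvg_eq_sum_child hF.norm, smul_eq_mul, mul_inv_cancel_left₀ (by positivity)]
  exact Finset.single_le_sum (f := fun c => cubeAvg (fun x => ‖F x‖) (I.child c))
    (fun c _ => cubeAvg_norm_nonneg F _) (Finset.mem_univ c)

theorem rpow_cubeAvg_norm_le {F : (Fin m → ℝ) → E} {I : DyadicCube m} {p : ℝ} (hp : 1 ≤ p)
    (hF : IntegrableOn F I.toSet) (hFp : IntegrableOn (fun x => ‖F x‖ ^ p) I.toSet) :
    cubeAvg (fun x => ‖F x‖) I ^ p ≤ cubeAvg (fun x => ‖F x‖ ^ p) I := by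
  refine (convexOn_rpow hp).map_set_average_le
    (Real.continuous_rpow_const (by linarith) |>.continuousOn) isClosed_Ici ?_
    (volume_toSet_ne_top I) (Filter.Eventually.of_forall fun x => norm_nonneg _) hF.norm hFp
  rw [volume_toSet]
  simpa using (pow_pos (zpow_pos (by norm_num : (0:ℝ) < 2) _) m)

/-- The mean square oscillation of the averages of `F` over the children of a cube. -/
noncomputable def osc [NormedSpace ℝ E] (F : (Fin m → ℝ) → E) (I : DyadicCube m) : ℝ :=
  ((2 : ℝ) ^ m)⁻¹ * ∑ c, ‖cubeAvg F (I.child c) - cubeAvg F I‖ ^ 2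

theorem osc_nonneg [NormedSpace ℝ E] (F : (Fin m → ℝ) → E) (I : DyadicCube m) : 0 ≤ osc F I := by
  unfold osc; positivity

theorem card_children : Fintype.card (Fin m → Bool) = 2 ^ m := by simp

/-- Pythagoras for one martingale step: the average over the cube is the mean of the averages over
its children, so the cross terms collapse. This is where the Bellman argument uses the inner
product. -/
theorem osc_eq [InnerProductSpace ℝ E] {F : (Fin m → ℝ) → E} {I : DyadicCube m}
    (hF : IntegrableOn F I.toSet) :
    ∑ c, ‖cubeAvg F (I.child c)‖ ^ 2 = 2 ^ m * (‖cubeAvg F I‖ ^ 2 + osc F I) := by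
  have h : ∑ c, cubeAvg F (I.child c) = (2 : ℝ) ^ m • cubeAvg F I := by
    rw [cubeAvg_eq_sum_child hF, smul_inv_smul₀ (by positivity)]
  have h2 : ∑ c, inner ℝ (cubeAvg F (I.child c)) (cubeAvg F I) = 2 ^ m * ‖cubeAvg F I‖ ^ 2 := by
    rw [← sum_inner, h, real_inner_smul_left, real_inner_self_eq_norm_sq]
  rw [mul_add, osc, mul_inv_cancel_left₀ (by positivity)]
  simp only [norm_sub_sq_real, Finset.sum_add_distrib, Finset.sum_sub_distrib, ← Finset.mul_sum,
    h2, Finset.sum_const, Finset.card_univ, card_children, nsmul_eq_mul]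
  push_cast
  ring

end Average

/-! ### Haar coefficients and the oscillation -/

/-- The two halves are dyadic intervals of scale `k + 1`, so a single floor determines the value. -/
theorem haarOne_eq (k n : ℤ) (e : Bool) (t : ℝ) :
    haarOne k n e t = Real.sqrt ((2 : ℝ) ^ k) *
      (if ⌊t * 2 ^ (k + 1)⌋ = 2 * n then 1
        else if ⌊t * 2 ^ (k + 1)⌋ = 2 * n + 1 then (if e then -1 else 1) else 0) := by
  have hk : (2 : ℝ) ^ (-(k + 1)) = 2 ^ (-k) / 2 := by
    rw [neg_add, zpow_add₀ two_ne_zero, zpow_neg_one, div_eq_mul_inv]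
  have h1 : t ∈ Set.Ico ((n : ℝ) * 2 ^ (-k)) (((n : ℝ) + 1 / 2) * 2 ^ (-k)) ↔
      ⌊t * 2 ^ (k + 1)⌋ = 2 * n := by
    rw [← mem_Ico_dyadic_iff, hk]; push_cast
    rw [show (2 * (n : ℝ)) * (2 ^ (-k) / 2) = n * 2 ^ (-k) by ring,
      show (2 * (n : ℝ) + 1) * (2 ^ (-k) / 2) = (n + 1 / 2) * 2 ^ (-k) by ring]
  have h2 : t ∈ Set.Ico (((n : ℝ) + 1 / 2) * 2 ^ (-k)) (((n : ℝ) + 1) * 2 ^ (-k)) ↔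
      ⌊t * 2 ^ (k + 1)⌋ = 2 * n + 1 := by
    rw [← mem_Ico_dyadic_iff, hk]; push_cast
    rw [show (2 * (n : ℝ) + 1) * (2 ^ (-k) / 2) = (n + 1 / 2) * 2 ^ (-k) by ring,
      show (2 * (n : ℝ) + 1 + 1) * (2 ^ (-k) / 2) = (n + 1) * 2 ^ (-k) by ring]
  simp only [haarOne, Set.indicator_apply, h1, h2, Pi.one_apply]
  congr 1
  split_ifs <;> first | omega | simp

@[fun_prop]
theorem measurable_haarOne (k n : ℤ) (e : Bool) : Measurable (haarOne k n e) := by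
  unfold haarOne
  refine measurable_const.mul (.add ?_ (measurable_const.mul ?_)) <;>
    exact measurable_const.indicator measurableSet_Ico

@[fun_prop]
theorem measurable_haarCube {m : ℕ} (I : DyadicCube m) (e : Sign m) :
    Measurable (haarCube I e) := by
  unfold haarCube; fun_prop

/-- The sign of a Walsh function on a child. -/
def walsh {m : ℕ} (e c : Fin m → Bool) : ℝ := ∏ j, if c j && e j then -1 else 1

theorem abs_walsh {m : ℕ} (e c : Fin m → Bool) : |walsh e c| = 1 := by
  rw [walsh, Finset.abs_prod]
  exact Finset.prod_eq_one fun j _ => by split_ifs <;> simp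

/-- The sum factors over coordinates, and a coordinate where the sign is `true` contributes the
factor `1 - 1`. -/
theorem sum_walsh {m : ℕ} (e : Sign m) : ∑ c, walsh e.1 c = 0 := by
  obtain ⟨j, hj⟩ := e.2
  have h := Finset.prod_univ_sum (fun _ : Fin m => (Finset.univ : Finset Bool))
    (fun j c => if c && e.1 j then (-1 : ℝ) else 1)
  rw [Fintype.piFinset_univ] at h
  rw [show ∑ c, walsh e.1 c = _ from h.symm]
  exact Finset.prod_eq_zero (Finset.mem_univ j) (by simp [hj])

theorem haarOne_child (k n : ℤ) (e b : Bool) {t : ℝ}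
    (ht : ⌊t * 2 ^ (k + 1)⌋ = 2 * n + (if b then 1 else 0)) :
    haarOne k n e t = Real.sqrt ((2 : ℝ) ^ k) * if b && e then -1 else 1 := by
  rw [haarOne_eq, ht]
  cases b <;> cases e <;> simp

theorem haarCube_child {m : ℕ} (I : DyadicCube m) (e : Sign m) (c : Fin m → Bool) {x : Fin m → ℝ}
    (hx : x ∈ (I.child c).toSet) : haarCube I e x = (Real.sqrt I.vol)⁻¹ * walsh e.1 c := by
  rw [mem_toSet_iff, DyadicCube.ext_iff'] at hx
  have h := fun j => haarOne_child I.scale (I.pos j) (e.1 j) (c j) (t := x j) (hx.2 j)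
  simp only [haarCube, h, Finset.prod_mul_distrib, walsh]
  congr 1
  rw [Finset.prod_const, Finset.card_univ, Fintype.card_fin, DyadicCube.vol, ← Real.sqrt_inv,
    ← inv_pow, zpow_neg, inv_inv]
  refine (Real.sqrt_eq_iff_mul_self_eq (by positivity) (by positivity)).2 ?_ |>.symm
  rw [← mul_pow, Real.mul_self_sqrt (by positivity)]

theorem haarCube_sq {m : ℕ} (I : DyadicCube m) (e : Sign m) {x : Fin m → ℝ}
    (hx : x ∈ I.toSet) : haarCube I e x ^ 2 = I.vol⁻¹ := by
  rw [iUnion_child] at hx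
  obtain ⟨c, hc⟩ := Set.mem_iUnion.1 hx
  rw [haarCube_child I e c hc, mul_pow, ← sq_abs (walsh _ _), abs_walsh, inv_pow,
    Real.sq_sqrt (vol_pos I).le, one_pow, mul_one]

theorem haarCube_eq_zero {m : ℕ} (I : DyadicCube m) (e : Sign m) {x : Fin m → ℝ}
    (hx : x ∉ I.toSet) : haarCube I e x = 0 := by
  rw [← support_haarCube I e] at hx
  simpa using hx

theorem abs_haarCube_le {m : ℕ} (I : DyadicCube m) (e : Sign m) (x : Fin m → ℝ) :
    |haarCube I e x| ≤ (Real.sqrt I.vol)⁻¹ := by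
  by_cases hx : x ∈ I.toSet
  · rw [← Real.sqrt_sq_eq_abs, haarCube_sq I e hx, Real.sqrt_inv]
  · rw [haarCube_eq_zero I e hx, abs_zero]; positivity

section Coefficient

variable {m : ℕ} {E : Type*} [NormedAddCommGroup E]

theorem integrableOn_haarCube_smul [NormedSpace ℝ E] {F : (Fin m → ℝ) → E} {I : DyadicCube m}
    (e : Sign m) {s : Set (Fin m → ℝ)} (hF : IntegrableOn F s) :
    IntegrableOn (fun x => haarCube I e x • F x) s :=
  hF.bdd_smul (Real.sqrt I.vol)⁻¹ (measurable_haarCube I e).aestronglyMeasurable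
    (Filter.Eventually.of_forall fun x => abs_haarCube_le I e x)

theorem integral_haarCube_smul [NormedSpace ℝ E] {F : (Fin m → ℝ) → E} {I : DyadicCube m}
    (e : Sign m) (hF : IntegrableOn F I.toSet) :
    ∫ x, haarCube I e x • F x =
      (Real.sqrt I.vol / 2 ^ m) • ∑ c, walsh e.1 c • (cubeAvg F (I.child c) - cubeAvg F I) := by
  have h1 : ∫ x, haarCube I e x • F x = ∫ x in I.toSet, haarCube I e x • F x := by
    refine (setIntegral_eq_integral_of_forall_compl_eq_zero fun x hx => ?_).symm
    rw [haarCube_eq_zero I e hx, zero_smul]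
  have h2 : ∀ c, ∫ x in (I.child c).toSet, haarCube I e x • F x =
      (Real.sqrt I.vol / 2 ^ m) • walsh e.1 c • cubeAvg F (I.child c) := fun c => by
    rw [setIntegral_congr_fun (g := fun x => ((Real.sqrt I.vol)⁻¹ * walsh e.1 c) • F x)
      (measurableSet_toSet _) fun x hx => by simp only [haarCube_child I e c hx], integral_smul,
      integral_eq_vol_smul_cubeAvg, vol_child, smul_smul, smul_smul]
    congr 1
    have h3 := vol_pos I
    have h4 : 0 < Real.sqrt I.vol := Real.sqrt_pos.2 h3
    field_simp
    rw [Real.sq_sqrt h3.le, mul_comm]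
  rw [h1, setIntegral_eq_sum_child (integrableOn_haarCube_smul e hF)]
  simp only [h2, ← Finset.smul_sum, smul_sub, Finset.sum_sub_distrib, ← Finset.sum_smul, sum_walsh,
    zero_smul, sub_zero]

/-- The Haar function is constant up to sign on the children and has mean zero, so only differences
from the average enter; Cauchy–Schwarz over the `2 ^ m` children finishes. -/
theorem norm_haarCoeff_sq_le [NormedSpace ℝ E] {F : (Fin m → ℝ) → E} {I : DyadicCube m}
    (e : Sign m) (hF : IntegrableOn F I.toSet) :
    ‖∫ x, haarCube I e x • F x‖ ^ 2 ≤ I.vol * osc F I := by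
  rw [integral_haarCube_smul e hF, norm_smul, mul_pow, Real.norm_of_nonneg (by positivity),
    div_pow, Real.sq_sqrt (vol_pos I).le, osc]
  have h : ‖∑ c, walsh e.1 c • (cubeAvg F (I.child c) - cubeAvg F I)‖ ^ 2 ≤
      2 ^ m * ∑ c, ‖cubeAvg F (I.child c) - cubeAvg F I‖ ^ 2 := by
    have h3 : ‖∑ c, walsh e.1 c • (cubeAvg F (I.child c) - cubeAvg F I)‖ ≤
        ∑ c, ‖cubeAvg F (I.child c) - cubeAvg F I‖ :=
      norm_sum_le_of_le _ fun c _ => by rw [norm_smul, Real.norm_eq_abs, abs_walsh, one_mul]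
    have := sq_sum_le_card_mul_sum_sq (s := Finset.univ)
      (f := fun c => ‖cubeAvg F (I.child c) - cubeAvg F I‖)
    rw [Finset.card_univ, card_children] at this
    push_cast at this
    exact (pow_le_pow_left₀ (norm_nonneg _) h3 2).trans this
  calc _ ≤ I.vol / (2 ^ m) ^ 2 * (2 ^ m * ∑ c, ‖cubeAvg F (I.child c) - cubeAvg F I‖ ^ 2) := by
        have := (vol_pos I).le
        gcongr
    _ = _ := by field_simp

theorem norm_haarCoeff_sq_mul_le [NormedSpace ℝ E] {F : (Fin m → ℝ) → E} {I : DyadicCube m}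
    (e : Sign m) (hF : IntegrableOn F I.toSet) (x : Fin m → ℝ) :
    ‖∫ y, haarCube I e y • F y‖ ^ 2 * haarCube I e x ^ 2 ≤ I.toSet.indicator 1 x * osc F I := by
  by_cases hx : x ∈ I.toSet
  · rw [haarCube_sq I e hx, Set.indicator_of_mem hx, Pi.one_apply, one_mul,
      mul_inv_le_iff₀ (vol_pos I), mul_comm]
    exact norm_haarCoeff_sq_le e hF
  · simp [haarCube_eq_zero I e hx, hx]

/-- A finite Haar square function is dominated by the conditional square function. -/
theorem sum_haarCoeff_le [NormedSpace ℝ E] {F : (Fin m → ℝ) → E}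
    (hF : ∀ I : DyadicCube m, IntegrableOn F I.toSet) (s : Finset (DyadicCube m × Sign m)) :
    ∃ (k : ℤ) (n : ℕ), ∀ x, ∑ r ∈ s, ‖∫ y, haarCube r.1 r.2 y • F y‖ ^ 2 * haarCube r.1 r.2 x ^ 2 ≤
      2 ^ m * ∑ j ∈ Finset.range n, osc F (cubeAt (k + j) x) := by
  classical
  obtain ⟨N, hN⟩ : ∃ N : ℕ, ∀ r ∈ s, -(N : ℤ) ≤ r.1.scale ∧ r.1.scale < N := by
    refine ⟨s.sup (fun r => r.1.scale.natAbs) + 1, fun r hr => ?_⟩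
    have := Finset.le_sup (f := fun r : DyadicCube m × Sign m => r.1.scale.natAbs) hr
    omega
  -- At a point `x` only the cubes containing `x` contribute, one per scale; the scales of `s` lie
  -- in `[-N, N)`, and each cube carries at most `2 ^ m` signs.
  refine ⟨-N, 2 * N, fun x => ?_⟩
  calc _ ≤ ∑ r ∈ s, r.1.toSet.indicator 1 x * osc F r.1 :=
        Finset.sum_le_sum fun r _ => norm_haarCoeff_sq_mul_le r.2 (hF _) x
    _ = ∑ r ∈ s with x ∈ r.1.toSet, osc F r.1 := by
        rw [Finset.sum_filter]
        exact Finset.sum_congr rfl fun r _ => by by_cases h : x ∈ r.1.toSet <;> simp [h]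
    _ ≤ ∑ r ∈ (Finset.range (2 * N)).image (fun j : ℕ => cubeAt (-N + j) x) ×ˢ
          (Finset.univ : Finset (Sign m)), osc F r.1 := by
        refine Finset.sum_le_sum_of_subset_of_nonneg (fun r hr => ?_) fun _ _ _ => osc_nonneg _ _
        rw [Finset.mem_filter] at hr
        obtain ⟨h1, h2⟩ := hN r hr.1
        rw [Finset.mem_product, Finset.mem_image]
        refine ⟨⟨(r.1.scale + N).toNat, by rw [Finset.mem_range]; omega, ?_⟩, Finset.mem_univ _⟩
        rw [← mem_toSet_iff.1 hr.2]
        congr 1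
        simp only [cubeAt]
        omega
    _ = Fintype.card (Sign m) * ∑ j ∈ Finset.range (2 * N), osc F (cubeAt (-N + j) x) := by
        rw [Finset.sum_product, Finset.sum_image]
        · simp [Finset.mul_sum]
        · intro i _ j _ h
          simpa [cubeAt] using congrArg DyadicCube.scale h
    _ ≤ _ := by
        have : (Fintype.card (Sign m) : ℝ) ≤ 2 ^ m := by
          rw [← Nat.cast_ofNat, ← Nat.cast_pow, ← card_children]
          exact_mod_cast Fintype.card_subtype_le _
        gcongr
        exact Finset.sum_nonneg fun _ _ => osc_nonneg _ _

end Coefficient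

/-! ### Elementary inequalities -/

theorem mul_rpow_sub_one_self {b r : ℝ} (hb : 0 ≤ b) (hr : 1 ≤ r) : b * b ^ (r - 1) = b ^ r := by
  conv_lhs => rw [← Real.rpow_one b]
  rw [Real.rpow_one, ← Real.rpow_one_add' hb (by linarith)]
  congr 1; ring

/-- Young's inequality with half of `b ^ r` left to be absorbed; the cases are whether `2 * c * a`
is at most `b`. -/
theorem mul_mul_rpow_sub_one_le {a b c r : ℝ} (ha : 0 ≤ a) (hb : 0 ≤ b) (hc : 0 ≤ c)
    (hr : 1 ≤ r) : c * a * b ^ (r - 1) ≤ b ^ r / 2 + c * (2 * c) ^ (r - 1) * a ^ r := by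
  rcases le_total (2 * (c * a)) b with h | h
  · have : c * a * b ^ (r - 1) ≤ b / 2 * b ^ (r - 1) := by gcongr; linarith
    rw [div_mul_eq_mul_div, mul_rpow_sub_one_self hb hr] at this
    have : 0 ≤ c * (2 * c) ^ (r - 1) * a ^ r := by positivity
    linarith
  · have h1 : b ^ (r - 1) ≤ (2 * c) ^ (r - 1) * a ^ (r - 1) := by
      rw [← Real.mul_rpow (by positivity) ha]
      exact Real.rpow_le_rpow hb (by linarith) (by linarith)
    have : c * a * b ^ (r - 1) ≤ c * a * ((2 * c) ^ (r - 1) * a ^ (r - 1)) := by gcongr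
    rw [show c * a * ((2 * c) ^ (r - 1) * a ^ (r - 1)) = c * (2 * c) ^ (r - 1) * (a * a ^ (r - 1))
      by ring, mul_rpow_sub_one_self ha hr] at this
    have : 0 ≤ b ^ r := by positivity
    linarith

theorem rpow_tangent_le {a b r : ℝ} (ha : 0 ≤ a) (hb : 0 < b) (hr : 1 ≤ r) :
    b ^ r + r * (a - b) * b ^ (r - 1) ≤ a ^ r := by
  have h := one_add_mul_self_le_rpow_one_add (s := a / b - 1) (p := r)
    (by have : 0 ≤ a / b := by positivity
        linarith) hr
  rw [add_sub_cancel, Real.div_rpow ha hb.le, le_div_iff₀ (by positivity)] at h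
  refine le_of_eq_of_le ?_ h
  rw [← mul_rpow_sub_one_self hb.le hr]
  field_simp

/-- Replaces the concave power of `A` by an expression linear in `A`, so that the martingale
identity `osc_eq` can be used. -/
theorem rpow_half_le {A L p : ℝ} (hA : 0 ≤ A) (hL : 0 < L) (hp0 : 0 < p) (hp : p ≤ 2) :
    A ^ (p / 2) ≤ A * L ^ (p - 2) + L ^ p := by
  have hL2 : ∀ r : ℝ, (L ^ 2) ^ (r / 2) = L ^ r := fun r => by
    rw [← Real.rpow_natCast, ← Real.rpow_mul hL.le]; congr 1; push_cast; ring
  rcases le_total A (L ^ 2) with h | h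
  · have h1 : A ^ (p / 2) ≤ L ^ p := by
      rw [← hL2]; exact Real.rpow_le_rpow hA h (by positivity)
    have : 0 ≤ A * L ^ (p - 2) := by positivity
    linarith
  · have hA' : 0 < A := lt_of_lt_of_le (by positivity) h
    have h1 : A ^ ((p - 2) / 2) ≤ L ^ (p - 2) := by
      rw [← hL2]; exact Real.rpow_le_rpow_of_nonpos (by positivity) h (by linarith)
    have h2 : A ^ (p / 2) = A * A ^ ((p - 2) / 2) := by
      rw [← Real.rpow_one_add' hA (by ring_nf; positivity)]; congr 1; ring
    rw [h2]
    have : 0 ≤ L ^ p := by positivity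
    have := mul_le_mul_of_nonneg_left h1 hA
    linarith

/-- The step inequality for the Bellman function of the square function, `1 < p ≤ 2`. -/
theorem bellman_step {A u φ L p N M D : ℝ} (hA : 0 ≤ A) (hL : 0 < L) (hφ : 0 ≤ φ)
    (huφ : u ≤ φ ^ 2) (hM : φ ≤ M * L) (hN : M + 1 ≤ N) (hM1 : 1 ≤ M) (hp1 : 1 < p) (hp2 : p ≤ 2)
    (hD : 0 ≤ D) :
    A * max L φ ^ (p - 2) - u * max L φ ^ (p - 2) - N * max L φ ^ p +
        D * ((p - 1) * max L φ ^ p - p * φ * max L φ ^ (p - 1)) ≤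
      A * L ^ (p - 2) - u * L ^ (p - 2) - N * L ^ p +
        D * ((p - 1) * L ^ p - p * φ * L ^ (p - 1)) := by
  rcases le_or_gt φ L with h | h
  · rw [max_eq_left h]
  rw [max_eq_right h.le]
  have hφ0 : 0 < φ := hL.trans h
  have e1 : φ * φ ^ (p - 1) = φ ^ p := mul_rpow_sub_one_self hφ hp1.le
  have e2 : ∀ x : ℝ, 0 < x → x ^ 2 * x ^ (p - 2) = x ^ p := fun x hx => by
    rw [← Real.rpow_natCast, ← Real.rpow_add hx]; congr 1; push_cast; ring
  have h1 : φ ^ (p - 2) ≤ L ^ (p - 2) := Real.rpow_le_rpow_of_nonpos hL h.le (by linarith)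
  have h2 : A * φ ^ (p - 2) ≤ A * L ^ (p - 2) := by gcongr
  have h3 : L ^ p + p * (φ - L) * L ^ (p - 1) ≤ φ ^ p := rpow_tangent_le hφ hL hp1.le
  have e3 : L * L ^ (p - 1) = L ^ p := mul_rpow_sub_one_self hL.le hp1.le
  -- The Doob term: at `L = φ` it equals `-φ ^ p`, and the tangent line of the convex power at `L`
  -- shows that it decreases.
  have h4 : (p - 1) * φ ^ p - p * φ * φ ^ (p - 1) ≤ (p - 1) * L ^ p - p * φ * L ^ (p - 1) := by
    have : p * φ * φ ^ (p - 1) = p * φ ^ p := by rw [mul_assoc, e1]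
    rw [this]
    nlinarith
  have h5 : (u - φ ^ 2) * (L ^ (p - 2) - φ ^ (p - 2)) ≤ 0 :=
    mul_nonpos_of_nonpos_of_nonneg (by linarith) (by linarith)
  -- The loss from changing the weight on `-u` is paid by the term `-N * L ^ p`. Factoring the
  -- difference of squares leaves `φ + L ≤ (M + 1) * L`, whence the condition on `N`.
  have h6 : φ ^ 2 * L ^ (p - 2) - L ^ p ≤ N * (φ ^ p - L ^ p) := by
    have h7 : (φ - L) * L ^ (p - 1) ≤ φ ^ p - L ^ p := by
      have : 0 ≤ (p - 1) * ((φ - L) * L ^ (p - 1)) :=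
        mul_nonneg (by linarith) (mul_nonneg (by linarith) (by positivity))
      nlinarith
    have e4 : L * L ^ (p - 2) = L ^ (p - 1) := by
      rw [← Real.rpow_one_add' hL.le (by linarith)]; congr 1; ring
    have h8 : φ ^ 2 * L ^ (p - 2) - L ^ p = (φ - L) * ((φ + L) * L ^ (p - 2)) := by
      rw [← e2 L hL]; ring
    have h9 : (φ + L) * L ^ (p - 2) ≤ N * L ^ (p - 1) := by
      rw [← e4, ← mul_assoc]; gcongr; nlinarith
    rw [h8]
    calc _ ≤ (φ - L) * (N * L ^ (p - 1)) := by gcongr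
      _ = N * ((φ - L) * L ^ (p - 1)) := by ring
      _ ≤ _ := by gcongr; linarith
  have h10 : L ^ p ≤ φ ^ p := Real.rpow_le_rpow hL.le h.le (by linarith)
  have h11 := mul_le_mul_of_nonneg_left h4 hD
  have e5 := e2 φ hφ0
  nlinarith

/-! ### Induction over the dyadic tree -/

section Tree

variable {m : ℕ} {E : Type*} [NormedAddCommGroup E]

theorem cubeAt_of_mem {I : DyadicCube m} {x : Fin m → ℝ} (hx : x ∈ I.toSet) :
    cubeAt I.scale x = I := mem_toSet_iff.1 hx

/-- The abstract Bellman induction. `A` is the square sum collected so far and `L` a positive bound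
for the averages of `‖F‖` met so far; `hT` is the majorisation and `hstep` the supermartingale
property. -/
theorem lintegral_rpow_sum_osc_le_of_bellman [NormedSpace ℝ E] {F : (Fin m → ℝ) → E} {r : ℝ}
    {T : DyadicCube m → ℝ → ℝ → ℝ}
    (hT : ∀ I A L, 0 ≤ A → 0 < L → cubeAvg (fun x => ‖F x‖) I ≤ L → A ^ r * I.vol ≤ T I A L)
    (hstep : ∀ I A L, 0 ≤ A → 0 < L → cubeAvg (fun x => ‖F x‖) I ≤ L →
      ∑ c, T (I.child c) (A + osc F I) (max L (cubeAvg (fun x => ‖F x‖) (I.child c))) ≤ T I A L)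
    (n : ℕ) : ∀ (I : DyadicCube m) (A L : ℝ), 0 ≤ A → 0 < L →
      cubeAvg (fun x => ‖F x‖) I ≤ L →
      ∫⁻ x in I.toSet, ENNReal.ofReal
        ((A + ∑ j ∈ Finset.range n, osc F (cubeAt (I.scale + j) x)) ^ r) ≤
          ENNReal.ofReal (T I A L) := by
  induction n with
  | zero =>
    intro I A L hA hL hφ
    simp only [Finset.range_zero, Finset.sum_empty, add_zero, lintegral_const,
      Measure.restrict_apply MeasurableSet.univ, Set.univ_inter]
    rw [volume_toSet, ← ENNReal.ofReal_mul (by positivity)]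
    exact ENNReal.ofReal_le_ofReal (hT I A L hA hL hφ)
  | succ n ih =>
    intro I A L hA hL hφ
    conv_lhs => rw [iUnion_child I]
    rw [lintegral_iUnion (fun c => measurableSet_toSet _) (pairwise_disjoint_child I), tsum_fintype]
    refine le_trans (Finset.sum_le_sum (g := fun c => ENNReal.ofReal (T (I.child c)
      (A + osc F I) (max L (cubeAvg (fun x => ‖F x‖) (I.child c))))) fun c _ => ?_) ?_
    · refine le_of_eq_of_le (setLIntegral_congr_fun (measurableSet_toSet _) fun x hx => ?_)
        (ih (I.child c) _ _ (add_nonneg hA (osc_nonneg _ _)) (lt_max_of_lt_left hL)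
          (le_max_right _ _))
      -- The first term of the sum is the oscillation of `I` itself, which moves into `A`; the
      -- remaining terms are those of the child, with scales shifted by one.
      rw [Finset.sum_range_succ', Nat.cast_zero, add_zero,
        cubeAt_of_mem (child_toSet_subset I c hx), add_assoc A, add_comm (osc F I)]
      simp only [DyadicCube.child, Nat.cast_add, Nat.cast_one, add_assoc, add_comm (1 : ℤ)]
    · rw [← ENNReal.ofReal_sum_of_nonneg fun c _ => ?_]
      · exact ENNReal.ofReal_le_ofReal (hstep I A L hA hL hφ)
      · refine le_trans ?_ (hT _ _ _ (add_nonneg hA (osc_nonneg _ _)) (lt_max_of_lt_left hL)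
          (le_max_right _ _))
        have := (vol_pos (I.child c)).le
        have : 0 ≤ A + osc F I := add_nonneg hA (osc_nonneg _ _)
        positivity

theorem vol_mul_rpow_cubeAvg_le {F : (Fin m → ℝ) → E} {I : DyadicCube m} {p : ℝ} (hp : 1 ≤ p)
    (hF : IntegrableOn F I.toSet) (hFp : IntegrableOn (fun x => ‖F x‖ ^ p) I.toSet) :
    I.vol * cubeAvg (fun x => ‖F x‖) I ^ p ≤ ∫ x in I.toSet, ‖F x‖ ^ p := by
  rw [integral_eq_vol_smul_cubeAvg, smul_eq_mul]
  exact mul_le_mul_of_nonneg_left (rpow_cubeAvg_norm_le hp hF hFp) (vol_pos I).le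

/-- Convexity of the power `p / 2` makes `A ^ (p / 2) - p / 2 * ‖avg‖ ^ 2 * A ^ (p / 2 - 1)` a
supermartingale: `osc_eq` adds to the squared average the same amount as is added to `A`. No maximal
function is needed, so `L` is ignored. -/
theorem lintegral_rpow_sum_osc_le_of_two_le (m : ℕ) {p : ℝ} (hp : 2 ≤ p) :
    ∃ K : ℝ, 0 ≤ K ∧ ∀ (E : Type) [NormedAddCommGroup E] [InnerProductSpace ℝ E]
      (F : (Fin m → ℝ) → E), (∀ I : DyadicCube m, IntegrableOn F I.toSet) →
      (∀ I : DyadicCube m, IntegrableOn (fun x => ‖F x‖ ^ p) I.toSet) →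
      ∀ (n : ℕ) (I : DyadicCube m), ∫⁻ x in I.toSet, ENNReal.ofReal
        ((∑ j ∈ Finset.range n, osc F (cubeAt (I.scale + j) x)) ^ (p / 2)) ≤
          ENNReal.ofReal (K * ∫ x in I.toSet, ‖F x‖ ^ p) := by
  have hq : 1 ≤ p / 2 := by linarith
  -- The inner factor is the constant of `mul_mul_rpow_sub_one_le` with `c = p / 2`; doubling makes
  -- up for the half that is absorbed.
  refine ⟨2 * (p / 2 * (2 * (p / 2)) ^ (p / 2 - 1)), by positivity, fun E _ _ F hF hFp n I => ?_⟩
  set K := p / 2 * (2 * (p / 2)) ^ (p / 2 - 1) with hK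
  have hK0 : 0 ≤ K := by positivity
  have h := lintegral_rpow_sum_osc_le_of_bellman (F := F) (r := p / 2)
    (T := fun I A _ => 2 * (I.vol * (A ^ (p / 2) - p / 2 * ‖cubeAvg F I‖ ^ 2 * A ^ (p / 2 - 1))) +
      2 * K * ∫ x in I.toSet, ‖F x‖ ^ p) ?_ ?_ n I 0
    (cubeAvg (fun x => ‖F x‖) I + 1) le_rfl
    (by have := cubeAvg_norm_nonneg F I; linarith) (by linarith)
  · simp only [zero_add] at h
    refine h.trans (ENNReal.ofReal_le_ofReal ?_)
    rw [Real.zero_rpow (by linarith), zero_sub]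
    have : 0 ≤ I.vol * (p / 2 * ‖cubeAvg F I‖ ^ 2 * 0 ^ (p / 2 - 1)) :=
      mul_nonneg (vol_pos I).le (by positivity)
    linarith
  · intro I A L hA _ _
    have h1 := mul_mul_rpow_sub_one_le (sq_nonneg ‖cubeAvg F I‖) hA (by linarith : 0 ≤ p / 2) hq
    rw [← hK, ← Real.rpow_natCast, ← Real.rpow_mul (norm_nonneg _),
      show ((2 : ℕ) : ℝ) * (p / 2) = p by push_cast; ring, Real.rpow_natCast] at h1
    have h2 : ‖cubeAvg F I‖ ^ p ≤ cubeAvg (fun x => ‖F x‖) I ^ p :=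
      Real.rpow_le_rpow (norm_nonneg _) (norm_cubeAvg_le F I) (by linarith)
    have h3 := vol_mul_rpow_cubeAvg_le (by linarith) (hF I) (hFp I)
    have h4 := mul_le_mul_of_nonneg_left h1 (vol_pos I).le
    have h5 := mul_le_mul_of_nonneg_left (mul_le_mul_of_nonneg_left h2 (vol_pos I).le) hK0
    have h6 := mul_le_mul_of_nonneg_left h3 hK0
    nlinarith
  · intro I A L hA _ _
    have hd := osc_nonneg F I
    set A' := A + osc F I with hA'
    have hA'0 : 0 ≤ A' := by positivity
    have h1 : A' ^ (p / 2) - p / 2 * (‖cubeAvg F I‖ ^ 2 + osc F I) * A' ^ (p / 2 - 1) ≤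
        A ^ (p / 2) - p / 2 * ‖cubeAvg F I‖ ^ 2 * A ^ (p / 2 - 1) := by
      have h2 : A ^ (p / 2 - 1) ≤ A' ^ (p / 2 - 1) :=
        Real.rpow_le_rpow hA (by linarith) (by linarith)
      have h3 : p / 2 * ‖cubeAvg F I‖ ^ 2 * A ^ (p / 2 - 1) ≤
        p / 2 * ‖cubeAvg F I‖ ^ 2 * A' ^ (p / 2 - 1) := by gcongr
      have h4 : A' ^ (p / 2) - p / 2 * osc F I * A' ^ (p / 2 - 1) ≤ A ^ (p / 2) := by
        rcases hA'0.eq_or_lt with h0 | h0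
        · have : A = 0 := by linarith
          have h6 : osc F I = 0 := by linarith
          rw [h6, this, ← h0]; simp
        · have := rpow_tangent_le hA h0 hq
          rw [show A - A' = - osc F I by rw [hA']; ring] at this
          linarith
      linarith
    have h2 : ∑ c, (A' ^ (p / 2) - p / 2 * ‖cubeAvg F (I.child c)‖ ^ 2 * A' ^ (p / 2 - 1)) =
        2 ^ m * (A' ^ (p / 2) - p / 2 * (‖cubeAvg F I‖ ^ 2 + osc F I) * A' ^ (p / 2 - 1)) := by
      rw [Finset.sum_sub_distrib, ← Finset.sum_mul, ← Finset.mul_sum, osc_eq (hF I)]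
      simp only [Finset.sum_const, Finset.card_univ, card_children, nsmul_eq_mul]
      push_cast
      ring
    rw [Finset.sum_add_distrib, ← Finset.mul_sum, ← Finset.mul_sum,
      ← setIntegral_eq_sum_child (hFp I)]
    simp only [vol_child]
    rw [← Finset.mul_sum, h2, ← mul_assoc (I.vol / 2 ^ m), div_mul_cancel₀ _ (by positivity)]
    have := mul_le_mul_of_nonneg_left h1 (vol_pos I).le
    linarith

/-- While `L` is unchanged, `(A - ‖avg‖ ^ 2) * L ^ (p - 2)` is a martingale by `osc_eq`;
`bellman_step` handles the increase of `L`. The multiple `D` of the Doob term restores positivity of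
the whole. -/
theorem lintegral_rpow_sum_osc_le_of_le_two (m : ℕ) {p : ℝ} (hp1 : 1 < p)
    (hp : p ≤ 2) :
    ∃ K : ℝ, 0 ≤ K ∧ ∀ (E : Type) [NormedAddCommGroup E] [InnerProductSpace ℝ E]
      (F : (Fin m → ℝ) → E), (∀ I : DyadicCube m, IntegrableOn F I.toSet) →
      (∀ I : DyadicCube m, IntegrableOn (fun x => ‖F x‖ ^ p) I.toSet) →
      ∀ (n : ℕ) (I : DyadicCube m), ∫⁻ x in I.toSet, ENNReal.ofReal
        ((∑ j ∈ Finset.range n, osc F (cubeAt (I.scale + j) x)) ^ (p / 2)) ≤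
          ENNReal.ofReal (K * ∫ x in I.toSet, ‖F x‖ ^ p) := by
  have hp0 : 0 < p - 1 := by linarith
  obtain ⟨N, hN⟩ : ∃ N : ℝ, N = 2 ^ m + 1 := ⟨_, rfl⟩
  have hN0 : 0 ≤ N := by rw [hN]; positivity
  -- The majorisation must cover `(N + 2) * L ^ p`: `N` from the correction term, one from
  -- `rpow_half_le`, one from `‖avg‖ ^ 2 ≤ L ^ 2`. The factor 2 compensates for Young's inequality
  -- keeping only half of `L ^ p`.
  obtain ⟨D, hD⟩ : ∃ D : ℝ, D = 2 * (N + 2) / (p - 1) := ⟨_, rfl⟩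
  have hD0 : 0 ≤ D := by rw [hD]; positivity
  obtain ⟨K₀, hK₀⟩ : ∃ K₀ : ℝ, K₀ = p / (p - 1) * (2 * (p / (p - 1))) ^ (p - 1) := ⟨_, rfl⟩
  have hK₀0 : 0 ≤ K₀ := by rw [hK₀]; positivity
  obtain ⟨K, hK⟩ : ∃ K : ℝ, K = 2 * (N + 2) * K₀ := ⟨_, rfl⟩
  have hK0 : 0 ≤ K := by rw [hK]; positivity
  have hDp : D * (p - 1) = 2 * (N + 2) := by rw [hD]; field_simp
  refine ⟨D * (p - 1) + K, by positivity, fun E _ _ F hF hFp n I => ?_⟩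
  have h := fun L => lintegral_rpow_sum_osc_le_of_bellman (F := F) (r := p / 2)
    (T := fun I A L => I.vol * (A * L ^ (p - 2) - ‖cubeAvg F I‖ ^ 2 * L ^ (p - 2) - N * L ^ p +
        D * ((p - 1) * L ^ p - p * cubeAvg (fun x => ‖F x‖) I * L ^ (p - 1))) +
      K * ∫ x in I.toSet, ‖F x‖ ^ p) ?_ ?_ n I 0 L le_rfl
  · simp only [zero_add] at h
    have hφ0 := cubeAvg_norm_nonneg F I
    have h1 : ∀ L, cubeAvg (fun x => ‖F x‖) I < L → ∫⁻ x in I.toSet, ENNReal.ofReal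
        ((∑ j ∈ Finset.range n, osc F (cubeAt (I.scale + j) x)) ^ (p / 2)) ≤
          ENNReal.ofReal (D * (p - 1) * (I.vol * L ^ p) + K * ∫ x in I.toSet, ‖F x‖ ^ p) := by
      intro L hL
      have hL0 : 0 < L := hφ0.trans_lt hL
      refine (h L hL0 hL.le).trans (ENNReal.ofReal_le_ofReal ?_)
      have h2 : 0 ≤ ‖cubeAvg F I‖ ^ 2 * L ^ (p - 2) := by positivity
      have h3 : 0 ≤ D * (p * cubeAvg (fun x => ‖F x‖) I * L ^ (p - 1)) := by positivity
      have h4 : 0 ≤ N * L ^ p := by positivity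
      have h5 : 0 * L ^ (p - 2) - ‖cubeAvg F I‖ ^ 2 * L ^ (p - 2) - N * L ^ p +
        D * ((p - 1) * L ^ p - p * cubeAvg (fun x => ‖F x‖) I * L ^ (p - 1)) ≤
          D * (p - 1) * L ^ p := by linarith
      have := mul_le_mul_of_nonneg_left h5 (vol_pos I).le
      linarith
    -- The natural start `L = avg ‖F‖` may vanish, where negative powers of `L` are useless; hence
    -- the limit from the right.
    have h2 : Filter.Tendsto (fun L : ℝ => ENNReal.ofReal (D * (p - 1) * (I.vol * L ^ p) +
        K * ∫ x in I.toSet, ‖F x‖ ^ p)) (nhdsWithin (cubeAvg (fun x => ‖F x‖) I)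
          (Set.Ioi (cubeAvg (fun x => ‖F x‖) I)))
        (nhds (ENNReal.ofReal (D * (p - 1) * (I.vol * cubeAvg (fun x => ‖F x‖) I ^ p) +
          K * ∫ x in I.toSet, ‖F x‖ ^ p))) := by
      refine Filter.Tendsto.mono_left (Continuous.tendsto ?_ _) nhdsWithin_le_nhds
      have := Real.continuous_rpow_const (q := p) (by linarith)
      exact ENNReal.continuous_ofReal.comp (by fun_prop)
    refine (ge_of_tendsto h2 (Filter.eventually_of_mem self_mem_nhdsWithin h1)).trans
      (ENNReal.ofReal_le_ofReal ?_)
    have h3 := vol_mul_rpow_cubeAvg_le hp1.le (hF I) (hFp I)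
    rw [add_mul]
    gcongr
  · intro I A L hA hL hφ
    have hφ0 := cubeAvg_norm_nonneg F I
    have hx := norm_cubeAvg_le F I
    have h1 := rpow_half_le hA hL (by linarith) hp
    have h2 := mul_mul_rpow_sub_one_le hφ0 hL.le (by positivity : 0 ≤ p / (p - 1)) hp1.le
    rw [← hK₀] at h2
    have h3 := vol_mul_rpow_cubeAvg_le hp1.le (hF I) (hFp I)
    have h4 : ‖cubeAvg F I‖ ^ 2 * L ^ (p - 2) ≤ L ^ p := by
      have e2 : L ^ 2 * L ^ (p - 2) = L ^ p := by
        rw [← Real.rpow_natCast, ← Real.rpow_add hL]; congr 1; push_cast; ring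
      rw [← e2]
      gcongr
      exact hx.trans hφ
    have h5 : (N + 2) * L ^ p ≤ D * ((p - 1) * L ^ p -
        p * cubeAvg (fun x => ‖F x‖) I * L ^ (p - 1)) +
          K * cubeAvg (fun x => ‖F x‖) I ^ p := by
      have e : D * ((p - 1) * L ^ p - p * cubeAvg (fun x => ‖F x‖) I * L ^ (p - 1)) =
          D * (p - 1) * (L ^ p - p / (p - 1) * cubeAvg (fun x => ‖F x‖) I * L ^ (p - 1)) := by
        field_simp
      rw [e, hDp, hK]
      have := mul_le_mul_of_nonneg_left h2 (by positivity : 0 ≤ 2 * (N + 2))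
      nlinarith
    have h6 : A ^ (p / 2) ≤ A * L ^ (p - 2) - ‖cubeAvg F I‖ ^ 2 * L ^ (p - 2) - N * L ^ p +
        D * ((p - 1) * L ^ p - p * cubeAvg (fun x => ‖F x‖) I * L ^ (p - 1)) +
          K * cubeAvg (fun x => ‖F x‖) I ^ p := by linarith
    have h7 := mul_le_mul_of_nonneg_left h6 (vol_pos I).le
    have h8 := mul_le_mul_of_nonneg_left h3 hK0
    linarith
  · intro I A L hA hL hφ
    have hd := osc_nonneg F I
    have hM1 : (1 : ℝ) ≤ 2 ^ m := one_le_pow₀ (by norm_num)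
    rw [Finset.sum_add_distrib, ← Finset.mul_sum (a := K), ← setIntegral_eq_sum_child (hFp I)]
    simp only [vol_child]
    rw [← Finset.mul_sum]
    refine add_le_add_left ?_ _
    refine (mul_le_mul_of_nonneg_left (Finset.sum_le_sum fun c _ => bellman_step (M := 2 ^ m)
      (p := p) (D := D) (N := N)
      (add_nonneg hA hd) hL (cubeAvg_norm_nonneg F (I.child c))
      (pow_le_pow_left₀ (norm_nonneg _) (norm_cubeAvg_le F (I.child c)) 2)
      ((cubeAvg_norm_child_le (hF I) c).trans (by gcongr)) hN.ge hM1 hp1 hp hD0)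
      (by have := (vol_pos I).le
          positivity)).trans_eq ?_
    have h1 : ∑ c, cubeAvg (fun x => ‖F x‖) (I.child c) =
        2 ^ m * cubeAvg (fun x => ‖F x‖) I := by
      rw [cubeAvg_eq_sum_child (hF I).norm, smul_eq_mul, mul_inv_cancel_left₀ (by positivity)]
    simp only [Finset.sum_add_distrib, Finset.sum_sub_distrib, ← Finset.sum_mul, ← Finset.mul_sum,
      osc_eq (hF I), h1, Finset.sum_const, Finset.card_univ, card_children, nsmul_eq_mul]
    push_cast
    field_simp
    ring

end Tree

/-! ### The one-parameter square function of a Hilbert space valued function -/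

theorem lintegral_eq_tsum_cubes {m : ℕ} (k : ℤ) (g : (Fin m → ℝ) → ℝ≥0∞) :
    ∫⁻ x, g x = ∑' n : Fin m → ℤ, ∫⁻ x in (⟨k, n⟩ : DyadicCube m).toSet, g x := by
  have h : (⋃ n : Fin m → ℤ, (⟨k, n⟩ : DyadicCube m).toSet) = Set.univ :=
    Set.eq_univ_of_forall fun x => Set.mem_iUnion.2 ⟨_, mem_cubeAt k x⟩
  rw [← setLIntegral_univ, ← h, lintegral_iUnion (fun n => measurableSet_toSet _)]
  intro n n' hn
  refine Set.disjoint_left.2 fun x hx hx' => hn ?_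
  have h1 : cubeAt k x = ⟨k, n⟩ := mem_toSet_iff.1 hx
  have h2 : cubeAt k x = ⟨k, n'⟩ := mem_toSet_iff.1 hx'
  simpa using h1.symm.trans h2

theorem lintegral_rpow_sum_osc_le (m : ℕ) {p : ℝ} (hp : 1 < p) :
    ∃ K : ℝ≥0∞, K ≠ ∞ ∧ ∀ (E : Type) [NormedAddCommGroup E] [InnerProductSpace ℝ E]
      (F : (Fin m → ℝ) → E), MemLp F (ENNReal.ofReal p) volume → ∀ (k : ℤ) (n : ℕ),
        ∫⁻ x, ENNReal.ofReal ((∑ j ∈ Finset.range n, osc F (cubeAt (k + j) x)) ^ (p / 2)) ≤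
          K * ∫⁻ x, ‖F x‖ₑ ^ p := by
  have hp0 : 0 < p := by linarith
  obtain ⟨K, hK0, hK⟩ : ∃ K : ℝ, 0 ≤ K ∧ ∀ (E : Type) [NormedAddCommGroup E]
      [InnerProductSpace ℝ E] (F : (Fin m → ℝ) → E),
      (∀ I : DyadicCube m, IntegrableOn F I.toSet) →
      (∀ I : DyadicCube m, IntegrableOn (fun x => ‖F x‖ ^ p) I.toSet) →
      ∀ (n : ℕ) (I : DyadicCube m), ∫⁻ x in I.toSet, ENNReal.ofReal
        ((∑ j ∈ Finset.range n, osc F (cubeAt (I.scale + j) x)) ^ (p / 2)) ≤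
          ENNReal.ofReal (K * ∫ x in I.toSet, ‖F x‖ ^ p) := by
    rcases le_total 2 p with h | h
    · exact lintegral_rpow_sum_osc_le_of_two_le m h
    · exact lintegral_rpow_sum_osc_le_of_le_two m hp h
  refine ⟨ENNReal.ofReal K, ENNReal.ofReal_ne_top, fun E _ _ F hF k n => ?_⟩
  have hint : ∀ I : DyadicCube m, IntegrableOn F I.toSet := fun I => by
    have : IsFiniteMeasure (volume.restrict I.toSet) :=
      isFiniteMeasure_restrict.2 (volume_toSet_ne_top I)
    exact memLp_one_iff_integrable.1 ((hF.restrict _).mono_exponent (by simpa using hp.le))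
  have hintp : Integrable (fun x => ‖F x‖ ^ p) := by
    have := hF.integrable_norm_rpow (by simpa using hp0) ENNReal.ofReal_ne_top
    rwa [ENNReal.toReal_ofReal hp0.le] at this
  rw [lintegral_eq_tsum_cubes k, lintegral_eq_tsum_cubes k (fun x => ‖F x‖ₑ ^ p),
    ← ENNReal.tsum_mul_left]
  refine ENNReal.tsum_le_tsum fun i => (hK E F hint (fun I => hintp.integrableOn) n ⟨k, i⟩).trans ?_
  rw [ENNReal.ofReal_mul hK0, ofReal_integral_eq_lintegral_ofReal hintp.integrableOn
    (Filter.Eventually.of_forall fun x => by positivity)]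
  refine mul_le_mul_right (le_of_eq (lintegral_congr fun x => ?_)) _
  rw [← ENNReal.ofReal_rpow_of_nonneg (norm_nonneg _) hp0.le, ofReal_norm]

theorem lintegral_haar_sum_le (m : ℕ) {p : ℝ} (hp : 1 < p) :
    ∃ K : ℝ≥0∞, K ≠ ∞ ∧ ∀ (E : Type) [NormedAddCommGroup E] [InnerProductSpace ℝ E]
      (F : (Fin m → ℝ) → E), AEStronglyMeasurable F volume →
      ∀ s : Finset (DyadicCube m × Sign m),
        ∫⁻ x, (∑ r ∈ s, ‖∫ y, haarCube r.1 r.2 y • F y‖ₑ ^ 2 * ‖haarCube r.1 r.2 x‖ₑ ^ 2) ^ (p / 2) ≤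
          K * ∫⁻ x, ‖F x‖ₑ ^ p := by
  have hp0 : 0 < p := by linarith
  obtain ⟨K, hKtop, hK⟩ := lintegral_rpow_sum_osc_le m hp
  -- The `+ 1` keeps the constant nonzero, so the bound is trivial when the right-hand integral is
  -- infinite. This permits use on slices not known to be in `L^p`.
  refine ⟨ENNReal.ofReal ((2 ^ m) ^ (p / 2)) * K + 1, by finiteness, fun E _ _ F hFm s => ?_⟩
  by_cases hfin : ∫⁻ x, ‖F x‖ₑ ^ p = ∞
  · rw [hfin, ENNReal.mul_top (by simp)]; exact le_top
  have hpp : (ENNReal.ofReal p).toReal = p := ENNReal.toReal_ofReal hp0.le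
  have hF : MemLp F (ENNReal.ofReal p) volume := by
    refine ⟨hFm, (eLpNorm_lt_top_iff_lintegral_rpow_enorm_lt_top (by simpa using hp0)
      ENNReal.ofReal_ne_top).2 ?_⟩
    rw [hpp]; exact Ne.lt_top hfin
  have hint : ∀ I : DyadicCube m, IntegrableOn F I.toSet := fun I => by
    have : IsFiniteMeasure (volume.restrict I.toSet) :=
      isFiniteMeasure_restrict.2 (volume_toSet_ne_top I)
    exact memLp_one_iff_integrable.1 ((hF.restrict _).mono_exponent (by simpa using hp.le))
  obtain ⟨k, n, h⟩ := sum_haarCoeff_le hint s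
  calc _ ≤ ∫⁻ x, ENNReal.ofReal ((2 ^ m) ^ (p / 2)) * ENNReal.ofReal
        ((∑ j ∈ Finset.range n, osc F (cubeAt (k + j) x)) ^ (p / 2)) := by
        refine lintegral_mono fun x => ?_
        rw [← ENNReal.ofReal_mul (by positivity), ← Real.mul_rpow (by positivity)
          (Finset.sum_nonneg fun _ _ => osc_nonneg _ _), ← ENNReal.ofReal_rpow_of_nonneg
          (mul_nonneg (by positivity) (Finset.sum_nonneg fun _ _ => osc_nonneg _ _))
          (by positivity)]
        refine ENNReal.rpow_le_rpow (le_trans (le_of_eq ?_) (ENNReal.ofReal_le_ofReal (h x)))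
          (by positivity)
        rw [ENNReal.ofReal_sum_of_nonneg fun _ _ => by positivity]
        refine Finset.sum_congr rfl fun r _ => ?_
        rw [ENNReal.ofReal_mul (by positivity), ENNReal.ofReal_pow (norm_nonneg _), ofReal_norm,
          ← sq_abs (haarCube _ _ _), ENNReal.ofReal_pow (abs_nonneg _), ← Real.norm_eq_abs,
          ofReal_norm]
    _ = ENNReal.ofReal ((2 ^ m) ^ (p / 2)) * ∫⁻ x, ENNReal.ofReal
        ((∑ j ∈ Finset.range n, osc F (cubeAt (k + j) x)) ^ (p / 2)) :=
        lintegral_const_mul' _ _ ENNReal.ofReal_ne_top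
    _ ≤ ENNReal.ofReal ((2 ^ m) ^ (p / 2)) * (K * ∫⁻ x, ‖F x‖ₑ ^ p) := by
        gcongr; exact hK E F hF k n
    _ ≤ _ := by rw [← mul_assoc]; gcongr; exact le_self_add

/-! ### The product Haar system -/

theorem memLp_haarCube {m : ℕ} (I : DyadicCube m) (e : Sign m) (q : ℝ≥0∞) :
    MemLp (haarCube I e) q volume := by
  have h : haarCube I e = I.toSet.indicator (haarCube I e) := by
    rw [← support_haarCube I e, Set.indicator_support]
  have : IsFiniteMeasure (volume.restrict I.toSet) :=
    isFiniteMeasure_restrict.2 (volume_toSet_ne_top I)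
  rw [h, memLp_indicator_iff_restrict (measurableSet_toSet I)]
  exact MemLp.of_bound (measurable_haarCube I e).aestronglyMeasurable (Real.sqrt I.vol)⁻¹
    (Filter.Eventually.of_forall fun x => abs_haarCube_le I e x)

@[fun_prop]
theorem measurable_B₁ {m : ℕ} (r : Index m) : Measurable (B₁ r) := by
  unfold B₁; fun_prop

theorem memLp_B₁ {m : ℕ} (r : Index m) (q : ℝ≥0∞) : MemLp (B₁ r) q volume := by
  have h : B₁ r = (r.1.1.toSet ×ˢ r.1.2.toSet).indicator (B₁ r) := by
    refine (Set.indicator_eq_self.2 fun x hx => ?_).symm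
    simp only [Function.mem_support, B₁, ne_eq, mul_eq_zero, not_or] at hx
    rw [← support_haarCube r.1.1 r.2.1, ← support_haarCube r.1.2 r.2.2]
    exact hx
  have hfin : volume (r.1.1.toSet ×ˢ r.1.2.toSet) ≠ ∞ := by
    rw [Measure.volume_eq_prod, Measure.prod_prod]
    exact ENNReal.mul_ne_top (volume_toSet_ne_top _) (volume_toSet_ne_top _)
  have : IsFiniteMeasure (volume.restrict (r.1.1.toSet ×ˢ r.1.2.toSet)) :=
    isFiniteMeasure_restrict.2 hfin
  rw [h, memLp_indicator_iff_restrict ((measurableSet_toSet _).prod (measurableSet_toSet _))]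
  refine MemLp.of_bound (measurable_B₁ r).aestronglyMeasurable
    ((Real.sqrt r.1.1.vol)⁻¹ * (Real.sqrt r.1.2.vol)⁻¹)
    (Filter.Eventually.of_forall fun x => ?_)
  rw [B₁, norm_mul]
  exact mul_le_mul (abs_haarCube_le _ _ _) (abs_haarCube_le _ _ _) (norm_nonneg _) (by positivity)

theorem integrable_mul_B₁ {m : ℕ} {f : Space m → ℂ} {p : ℝ≥0∞} (hp : 1 ≤ p)
    (hf : MemLp f p volume) (r : Index m) : Integrable (fun y => f y * (B₁ r y : ℂ)) := by
  have := ENNReal.HolderConjugate.conjExponent hp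
  exact hf.integrable_mul ((memLp_B₁ r (ENNReal.conjExponent p)).ofReal (K := ℂ))

theorem sum_index_le {m : ℕ} (s : Finset (Index m)) :
    ∃ s₁ s₂ : Finset (DyadicCube m × Sign m), ∀ g : Index m → ℝ≥0∞,
      ∑ r ∈ s, g r ≤ ∑ a ∈ s₁, ∑ b ∈ s₂, g ((a.1, b.1), (a.2, b.2)) := by
  classical
  refine ⟨s.image fun r => (r.1.1, r.2.1), s.image fun r => (r.1.2, r.2.2), fun g => ?_⟩
  rw [← Finset.sum_product', ← Finset.sum_image (g := fun r : Index m =>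
    ((r.1.1, r.2.1), (r.1.2, r.2.2)))
    (f := fun z : (DyadicCube m × Sign m) × (DyadicCube m × Sign m) =>
      g ((z.1.1, z.2.1), (z.1.2, z.2.2)))]
  · refine Finset.sum_le_sum_of_subset fun z hz => ?_
    obtain ⟨r, hr, rfl⟩ := Finset.mem_image.1 hz
    exact Finset.mem_product.2 ⟨Finset.mem_image_of_mem _ hr, Finset.mem_image_of_mem _ hr⟩
  · rintro ⟨⟨_, _⟩, _, _⟩ _ ⟨⟨_, _⟩, _, _⟩ _ h
    simpa [and_assoc, and_left_comm, and_comm] using h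

theorem enorm_sq_eq_sum {ι : Type} [Fintype ι] (v : PiLp 2 fun _ : ι => ℂ) :
    ‖v‖ₑ ^ 2 = ∑ i, ‖v i‖ₑ ^ 2 := by
  rw [← ofReal_norm, ← ENNReal.ofReal_pow (norm_nonneg _), PiLp.norm_sq_eq_of_L2,
    ENNReal.ofReal_sum_of_nonneg fun _ _ => by positivity]
  exact Finset.sum_congr rfl fun i _ => by rw [ENNReal.ofReal_pow (norm_nonneg _), ofReal_norm]

theorem rpow_half_sq {p : ℝ} (a : ℝ≥0∞) : (a ^ 2) ^ (p / 2) = a ^ p := by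
  rw [← ENNReal.rpow_natCast, ← ENNReal.rpow_mul]; congr 1; push_cast; ring

/-- The Haar coefficient of `f` in the second variable. -/
noncomputable def sectionCoeff {m : ℕ} (f : Space m → ℂ) (b : DyadicCube m × Sign m)
    (x₁ : Fin m → ℝ) : ℂ := ∫ y, haarCube b.1 b.2 y • f (x₁, y)

/-- The vector of the Haar terms of `f` in the second variable. -/
noncomputable def sectionHaar {m : ℕ} (f : Space m → ℂ) (s : Finset (DyadicCube m × Sign m))
    (x₁ x₂ : Fin m → ℝ) : PiLp 2 fun _ : s => ℂ :=
  WithLp.toLp 2 fun b => haarCube b.1.1 b.1.2 x₂ • sectionCoeff f b x₁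

section Section

variable {m : ℕ} {f : Space m → ℂ}

theorem stronglyMeasurable_sectionCoeff (hf : StronglyMeasurable f) (b : DyadicCube m × Sign m) :
    StronglyMeasurable (sectionCoeff f b) :=
  StronglyMeasurable.integral_prod_right
    (((measurable_haarCube b.1 b.2).comp measurable_snd).stronglyMeasurable.smul hf)

theorem stronglyMeasurable_sectionHaar (hf : StronglyMeasurable f)
    (s : Finset (DyadicCube m × Sign m)) :
    StronglyMeasurable fun z : Space m => sectionHaar f s z.1 z.2 := by
  refine (PiLp.continuous_toLp 2 _).comp_stronglyMeasurable
    (measurable_pi_lambda _ fun b => ?_).stronglyMeasurable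
  exact ((measurable_haarCube b.1.1 b.1.2).comp measurable_snd).smul
    ((stronglyMeasurable_sectionCoeff hf b.1).measurable.comp measurable_fst)

theorem haarCube_smul_sectionCoeff (a b : DyadicCube m × Sign m) (x₁ : Fin m → ℝ) :
    haarCube a.1 a.2 x₁ • sectionCoeff f b x₁ =
      ∫ y, f (x₁, y) * (B₁ ((a.1, b.1), (a.2, b.2)) (x₁, y) : ℂ) := by
  rw [sectionCoeff, ← integral_smul]
  refine integral_congr_ae (Filter.Eventually.of_forall fun y => ?_)
  simp only [B₁, Complex.real_smul, Complex.ofReal_mul]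
  ring

/-- By Fubini, the first-variable Haar coefficients of the vector of second-variable Haar terms are
the product coefficients, weighted by the Haar functions of `x₂`. -/
theorem enorm_haarCoeff_sectionHaar
    (hf : ∀ r, Integrable fun y => f y * (B₁ r y : ℂ)) (a : DyadicCube m × Sign m)
    (s : Finset (DyadicCube m × Sign m)) (x₂ : Fin m → ℝ) :
    ‖∫ x₁, haarCube a.1 a.2 x₁ • sectionHaar f s x₁ x₂‖ₑ ^ 2 =
      ∑ b ∈ s, ‖∫ y, f y * (B₁ ((a.1, b.1), (a.2, b.2)) y : ℂ)‖ₑ ^ 2 *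
        ‖haarCube b.1 b.2 x₂‖ₑ ^ 2 := by
  have h1 : ∀ (b : s) x₁, (haarCube a.1 a.2 x₁ • sectionHaar f s x₁ x₂) b =
      haarCube b.1.1 b.1.2 x₂ •
        ∫ y, f (x₁, y) * (B₁ ((a.1, b.1.1), (a.2, b.1.2)) (x₁, y) : ℂ) := fun b x₁ => by
    rw [PiLp.smul_apply, ← haarCube_smul_sectionCoeff, smul_comm]; rfl
  rw [enorm_sq_eq_sum, ← Finset.sum_coe_sort s]
  refine Finset.sum_congr rfl fun b _ => ?_
  rw [eval_integral_piLp fun b => ?_]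
  · simp only [h1, integral_smul, enorm_smul, mul_pow]
    rw [mul_comm, Measure.volume_eq_prod, integral_prod _ (hf _)]
  · simp only [h1]
    exact Integrable.smul (haarCube b.1.1 b.1.2 x₂) (hf _).integral_prod_left

theorem enorm_sectionHaar_rpow (s : Finset (DyadicCube m × Sign m)) (x₁ x₂ : Fin m → ℝ) (p : ℝ) :
    ‖sectionHaar f s x₁ x₂‖ₑ ^ p = (∑ b ∈ s, ‖∫ y, haarCube b.1 b.2 y • f (x₁, y)‖ₑ ^ 2 *
      ‖haarCube b.1 b.2 x₂‖ₑ ^ 2) ^ (p / 2) := by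
  rw [← rpow_half_sq, enorm_sq_eq_sum, ← Finset.sum_coe_sort s]
  congr 1
  refine Finset.sum_congr rfl fun b _ => ?_
  simp only [sectionHaar, sectionCoeff, enorm_smul, mul_pow]
  rw [mul_comm]

end Section

theorem lintegral_B₁_sum_le (m : ℕ) {p : ℝ} (hp : 1 < p) :
    ∃ K : ℝ≥0∞, K ≠ ∞ ∧ ∀ f : Space m → ℂ, StronglyMeasurable f →
      MemLp f (ENNReal.ofReal p) volume → ∀ s : Finset (Index m),
        ∫⁻ x, (∑ r ∈ s, ‖∫ y, f y * (B₁ r y : ℂ)‖ₑ ^ 2 * ‖B₁ r x‖ₑ ^ 2) ^ (p / 2) ≤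
          K * ∫⁻ x, ‖f x‖ₑ ^ p := by
  have hp0 : 0 < p := by linarith
  obtain ⟨K, hKtop, hK⟩ := lintegral_haar_sum_le m hp
  refine ⟨K * K, by finiteness, fun f hfm hf s => ?_⟩
  obtain ⟨s₁, s₂, hs⟩ := sum_index_le s
  have hint := fun r => integrable_mul_B₁ (by simpa using hp.le) hf r
  have hFm := stronglyMeasurable_sectionHaar hfm s₂
  calc _ ≤ ∫⁻ x : Space m, (∑ a ∈ s₁, ∑ b ∈ s₂,
        ‖∫ y, f y * (B₁ ((a.1, b.1), (a.2, b.2)) y : ℂ)‖ₑ ^ 2 *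
          ‖B₁ ((a.1, b.1), (a.2, b.2)) x‖ₑ ^ 2) ^ (p / 2) :=
        lintegral_mono fun x => ENNReal.rpow_le_rpow
          (hs fun r => ‖∫ y, f y * (B₁ r y : ℂ)‖ₑ ^ 2 * ‖B₁ r x‖ₑ ^ 2) (half_pos hp0).le
    _ = ∫⁻ x₂, ∫⁻ x₁, (∑ a ∈ s₁, ∑ b ∈ s₂,
        ‖∫ y, f y * (B₁ ((a.1, b.1), (a.2, b.2)) y : ℂ)‖ₑ ^ 2 *
          ‖B₁ ((a.1, b.1), (a.2, b.2)) (x₁, x₂)‖ₑ ^ 2) ^ (p / 2) :=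
        lintegral_prod_symm _ (by fun_prop)
    _ = ∫⁻ x₂, ∫⁻ x₁, (∑ a ∈ s₁, ‖∫ y, haarCube a.1 a.2 y • sectionHaar f s₂ y x₂‖ₑ ^ 2 *
          ‖haarCube a.1 a.2 x₁‖ₑ ^ 2) ^ (p / 2) := by
        refine lintegral_congr fun x₂ => lintegral_congr fun x₁ => ?_
        congr 1
        refine Finset.sum_congr rfl fun a _ => ?_
        rw [enorm_haarCoeff_sectionHaar hint, Finset.sum_mul]
        refine Finset.sum_congr rfl fun b _ => ?_
        rw [B₁, enorm_mul, mul_pow, mul_assoc, mul_comm (‖haarCube a.1 a.2 x₁‖ₑ ^ 2)]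
    -- For fixed `x₂` this is the Hilbert-valued estimate in `x₁`. The norm of the vector is the
    -- scalar square function of the slice `f (x₁, ·)`, treated next for fixed `x₁`.
    _ ≤ ∫⁻ x₂, K * ∫⁻ x₁, ‖sectionHaar f s₂ x₁ x₂‖ₑ ^ p := lintegral_mono fun x₂ =>
        hK _ (fun x₁ => sectionHaar f s₂ x₁ x₂)
          (hFm.comp_measurable measurable_prodMk_right).aestronglyMeasurable s₁
    _ = K * ∫⁻ x₁, ∫⁻ x₂, ‖sectionHaar f s₂ x₁ x₂‖ₑ ^ p := by
        rw [lintegral_const_mul' _ _ hKtop, lintegral_lintegral_swap]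
        exact ((hFm.enorm.pow_const p).comp measurable_swap).aemeasurable
    _ ≤ K * ∫⁻ x₁, K * ∫⁻ x₂, ‖f (x₁, x₂)‖ₑ ^ p := by
        refine mul_le_mul_right (lintegral_mono fun x₁ => ?_) _
        simp only [enorm_sectionHaar_rpow]
        exact hK ℂ (fun x₂ => f (x₁, x₂))
          (hfm.comp_measurable measurable_prodMk_left).aestronglyMeasurable s₂
    _ = K * K * ∫⁻ x, ‖f x‖ₑ ^ p := by
        rw [lintegral_const_mul' _ _ hKtop, ← mul_assoc, Measure.volume_eq_prod,
          lintegral_prod _ (hfm.enorm.pow_const p).aemeasurable]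

/-- Monotone convergence along the directed family of finite partial sums. -/
theorem lintegral_rpow_tsum_le {ι α : Type*} [Countable ι] [MeasurableSpace α] {μ : Measure α}
    {g : ι → α → ℝ≥0∞} (hg : ∀ i, Measurable (g i)) {r : ℝ} (hr : 0 < r) {B : ℝ≥0∞}
    (h : ∀ s : Finset ι, ∫⁻ x, (∑ i ∈ s, g i x) ^ r ∂μ ≤ B) :
    ∫⁻ x, (∑' i, g i x) ^ r ∂μ ≤ B := by
  have h1 : ∀ x, (∑' i, g i x) ^ r = ⨆ s : Finset ι, (∑ i ∈ s, g i x) ^ r := fun x => by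
    rw [ENNReal.tsum_eq_iSup_sum]
    exact (ENNReal.orderIsoRpow r hr).map_iSup _
  simp only [h1]
  rw [lintegral_iSup_directed (fun s => by fun_prop)]
  · exact iSup_le h
  · refine directed_of_isDirected_le fun s t hst x => ENNReal.rpow_le_rpow ?_ hr.le
    exact Finset.sum_le_sum_of_subset hst

theorem squareFunction_congr_ae {m : ℕ} {h : Index m → Space m → ℝ} {f g : Space m → ℂ}
    (hfg : f =ᵐ[volume] g) : squareFunction h f = squareFunction h g := by
  ext x
  unfold squareFunction
  congr 2
  ext r
  rw [integral_congr_ae (g := fun y => g y * (h r y : ℂ)) (hfg.mono fun y hy => by simp only [hy])]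

theorem squareFunction_rpow {m : ℕ} (h : Index m → Space m → ℝ) (f : Space m → ℂ) (x : Space m)
    (p : ℝ) : squareFunction h f x ^ p =
      (∑' r, ‖∫ y, f y * (h r y : ℂ)‖ₑ ^ 2 * ‖h r x‖ₑ ^ 2) ^ (p / 2) := by
  rw [squareFunction, ← ENNReal.rpow_mul]
  congr 1
  · refine tsum_congr fun r => ?_
    rw [enorm_mul, mul_pow]
    congr 2
    rw [← ofReal_norm, Complex.norm_real, ofReal_norm]
  · ring

@[fun_prop]
theorem measurable_squareFunction_B₁ {m : ℕ} (f : Space m → ℂ) :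
    Measurable (squareFunction B₁ f) := by
  unfold squareFunction
  refine Measurable.pow_const (Measurable.tsum fun r => ?_) _
  fun_prop

theorem lintegral_squareFunction_B₁_le (m : ℕ) {p : ℝ} (hp : 1 < p) :
    ∃ K : ℝ≥0∞, K ≠ ∞ ∧ ∀ f : Space m → ℂ, MemLp f (ENNReal.ofReal p) volume →
      ∫⁻ x, squareFunction B₁ f x ^ p ≤ K * ∫⁻ x, ‖f x‖ₑ ^ p := by
  obtain ⟨K, hKtop, hK⟩ := lintegral_B₁_sum_le m hp
  refine ⟨K, hKtop, fun f hf => ?_⟩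
  obtain ⟨g, hg, hae⟩ := hf.aestronglyMeasurable
  rw [squareFunction_congr_ae hae, lintegral_congr_ae (f := fun x => ‖f x‖ₑ ^ p)
    (g := fun x => ‖g x‖ₑ ^ p) (hae.mono fun x hx => by simp only [hx])]
  simp only [squareFunction_rpow]
  exact lintegral_rpow_tsum_le (fun r => by fun_prop) (by linarith)
    (hK g hg ((memLp_congr_ae hae).1 hf))

/-! ### Orthonormality of the Haar systems -/

theorem floor_mul_zpow_of_le (t : ℝ) {k l : ℤ} (h : k ≤ l) :
    ⌊t * 2 ^ k⌋ = ⌊t * 2 ^ l⌋ / 2 ^ (l - k).toNat := by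
  have h1 : t * 2 ^ k = t * 2 ^ l / ((2 ^ (l - k).toNat : ℕ) : ℝ) := by
    rw [Nat.cast_pow, Nat.cast_ofNat, ← zpow_natCast, Int.toNat_of_nonneg (by omega), mul_div_assoc,
      ← zpow_sub₀ two_ne_zero]
    congr 2; ring
  rw [h1, Int.floor_div_natCast]; push_cast; rfl

theorem haarOne_eq_zero_of_ne {k n : ℤ} {e : Bool} {t : ℝ} (h : ⌊t * 2 ^ k⌋ ≠ n) :
    haarOne k n e t = 0 := by
  by_contra h0
  exact h (mem_Ico_dyadic_iff.1 (by rw [← support_haarOne k n e]; exact h0))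

theorem integral_haarOne (k n : ℤ) (e : Bool) :
    ∫ t, haarOne k n e t = if e then 0 else Real.sqrt (2 ^ k) * 2 ^ (-k) := by
  have h2 : (0 : ℝ) < 2 ^ (-k) := by positivity
  have hi : ∀ a b : ℝ, Integrable (Set.indicator (Set.Ico a b) (1 : ℝ → ℝ)) := fun a b =>
    (integrable_indicator_iff measurableSet_Ico).2 (integrableOn_const (by simp))
  have h1 : ∀ a b : ℝ, a ≤ b → ∫ t, Set.indicator (Set.Ico a b) (1 : ℝ → ℝ) t = b - a :=
    fun a b hab => by
      rw [integral_indicator_one measurableSet_Ico, Measure.real, Real.volume_Ico,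
        ENNReal.toReal_ofReal (by linarith)]
  simp only [haarOne]
  rw [integral_const_mul, integral_add (hi _ _) ((hi _ _).const_mul _), integral_const_mul,
    h1 _ _ (by nlinarith), h1 _ _ (by nlinarith)]
  cases e <;> simp <;> ring_nf <;> simp

theorem haarOne_mul_self (k n : ℤ) (e e' : Bool) (t : ℝ) :
    haarOne k n e t * haarOne k n e' t = Real.sqrt (2 ^ k) * haarOne k n (e ^^ e') t := by
  simp only [haarOne_eq]
  cases e <;> cases e' <;> split_ifs <;> simp_all

/-- The coarser function is constant on the finer interval, here equal to its value at the left
endpoint, and the finer one has mean zero. -/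
theorem integral_haarOne_mul_of_lt {k n k' n' : ℤ} (e : Bool) (h : k < k') :
    ∫ t, haarOne k n e t * haarOne k' n' true t = 0 := by
  have h1 : ∀ t, haarOne k n e t * haarOne k' n' true t =
      haarOne k n e (n' * 2 ^ (-k')) * haarOne k' n' true t := fun t => by
    by_cases ht : ⌊t * 2 ^ k'⌋ = n'
    · have h2 : ⌊((n' : ℝ) * 2 ^ (-k')) * 2 ^ k'⌋ = n' := by
        rw [mul_assoc, ← zpow_add₀ two_ne_zero]; simp
      rw [haarOne_eq k, haarOne_eq k, floor_mul_zpow_of_le t (Int.add_one_le_of_lt h),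
        floor_mul_zpow_of_le (n' * 2 ^ (-k')) (Int.add_one_le_of_lt h), h2, ht]
    · rw [haarOne_eq_zero_of_ne ht, mul_zero, mul_zero]
  simp only [h1]
  rw [integral_const_mul, integral_haarOne]
  simp

theorem integral_haarCube_mul {m : ℕ} (I J : DyadicCube m) (e e' : Fin m → Bool) :
    ∫ x : Fin m → ℝ, (∏ j, haarOne I.scale (I.pos j) (e j) (x j)) *
      (∏ j, haarOne J.scale (J.pos j) (e' j) (x j)) =
      ∏ j, ∫ t, haarOne I.scale (I.pos j) (e j) t * haarOne J.scale (J.pos j) (e' j) t := by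
  simp only [← Finset.prod_mul_distrib]
  exact integral_fintype_prod_volume_eq_prod
    (fun j t => haarOne I.scale (I.pos j) (e j) t * haarOne J.scale (J.pos j) (e' j) t)

theorem integral_haarCube_mul_of_lt {m : ℕ} {I J : DyadicCube m} (e e' : Sign m)
    (h : I.scale < J.scale) : ∫ x, haarCube I e x * haarCube J e' x = 0 := by
  obtain ⟨j, hj⟩ := e'.2
  simp only [haarCube]
  rw [integral_haarCube_mul]
  refine Finset.prod_eq_zero (Finset.mem_univ j) ?_
  rw [hj, integral_haarOne_mul_of_lt _ h]

theorem integral_haarCube_mul_self {m : ℕ} (I : DyadicCube m) (e : Sign m) :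
    ∫ x, haarCube I e x * haarCube I e x = 1 := by
  simp only [haarCube]
  rw [integral_haarCube_mul]
  refine Finset.prod_eq_one fun j _ => ?_
  simp only [haarOne_mul_self, integral_const_mul, integral_haarOne, Bool.xor_self]
  rw [if_neg (by simp), ← mul_assoc, Real.mul_self_sqrt (by positivity), ← zpow_add₀ two_ne_zero]
  simp

theorem integral_haarCube_mul_of_ne {m : ℕ} {I J : DyadicCube m} {e e' : Sign m}
    (h : (I, e) ≠ (J, e')) : ∫ x, haarCube I e x * haarCube J e' x = 0 := by
  rcases lt_trichotomy I.scale J.scale with hs | hs | hs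
  · exact integral_haarCube_mul_of_lt e e' hs
  · have h1 : ∃ j, ∫ t, haarOne I.scale (I.pos j) (e.1 j) t *
        haarOne J.scale (J.pos j) (e'.1 j) t = 0 := by
      by_cases hIJ : I = J
      · subst hIJ
        have he : e.1 ≠ e'.1 := fun he => h (by rw [Subtype.ext he])
        obtain ⟨j, hj⟩ := Function.ne_iff.1 he
        refine ⟨j, ?_⟩
        simp only [haarOne_mul_self, integral_const_mul, integral_haarOne]
        rw [if_pos (by simpa using hj), mul_zero]
      · obtain ⟨j, hj⟩ : ∃ j, I.pos j ≠ J.pos j := by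
          by_contra! hc
          exact hIJ (DyadicCube.ext_iff'.2 ⟨hs, hc⟩)
        refine ⟨j, ?_⟩
        rw [← hs]
        refine (integral_congr_ae (Filter.Eventually.of_forall fun t => ?_)).trans
          (integral_zero ℝ ℝ)
        by_cases ht : ⌊t * 2 ^ I.scale⌋ = I.pos j
        · simp only [haarOne_eq_zero_of_ne (show ⌊t * 2 ^ I.scale⌋ ≠ J.pos j by rwa [ht]), mul_zero]
        · simp only [haarOne_eq_zero_of_ne ht, zero_mul]
    obtain ⟨j, hj⟩ := h1
    simp only [haarCube]
    rw [integral_haarCube_mul]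
    exact Finset.prod_eq_zero (Finset.mem_univ j) hj
  · simp only [mul_comm (haarCube I e _)]
    exact integral_haarCube_mul_of_lt e' e hs

theorem integral_B₁_mul {m : ℕ} (r s : Index m) :
    ∫ x, B₁ r x * B₁ s x = (∫ x, haarCube r.1.1 r.2.1 x * haarCube s.1.1 s.2.1 x) *
      ∫ x, haarCube r.1.2 r.2.2 x * haarCube s.1.2 s.2.2 x := by
  rw [← integral_prod_mul, Measure.volume_eq_prod]
  congr 1
  ext x
  simp only [B₁]
  ring

theorem integral_B₁_mul_self {m : ℕ} (r : Index m) : ∫ x, B₁ r x * B₁ r x = 1 := by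
  rw [integral_B₁_mul, integral_haarCube_mul_self, integral_haarCube_mul_self, one_mul]

theorem integral_B₁_mul_of_ne {m : ℕ} {r s : Index m} (h : r ≠ s) :
    ∫ x, B₁ r x * B₁ s x = 0 := by
  rw [integral_B₁_mul]
  by_cases h1 : (r.1.1, r.2.1) = (s.1.1, s.2.1)
  · rw [integral_haarCube_mul_of_ne (I := r.1.2), mul_zero]
    intro h2
    obtain ⟨⟨_, _⟩, _, _⟩ := r
    obtain ⟨⟨_, _⟩, _, _⟩ := s
    simp_all
  · rw [integral_haarCube_mul_of_ne h1, zero_mul]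

/-! ### Density of the product Haar system -/

/-- Complex linear combinations of the product Haar functions. -/
noncomputable def haarSpan (m : ℕ) : Submodule ℂ (Space m → ℂ) :=
  Submodule.span ℂ (Set.range fun (r : Index m) x => (B₁ r x : ℂ))

theorem memLp_of_mem_haarSpan {m : ℕ} {g : Space m → ℂ} (hg : g ∈ haarSpan m) (q : ℝ≥0∞) :
    MemLp g q volume := by
  induction hg using Submodule.span_induction with
  | mem x hx => obtain ⟨r, rfl⟩ := hx; exact (memLp_B₁ r q).ofReal
  | zero => exact MemLp.zero'
  | add x y _ _ hx hy => exact hx.add hy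
  | smul a x _ hx => exact hx.const_smul a

/-- The functions of `L^q` that are limits of linear combinations of product Haar functions. -/
noncomputable def haarClosure (m : ℕ) (q : ℝ≥0∞) (hq : 1 ≤ q) : Submodule ℂ (Space m → ℂ) where
  carrier := {g | MemLp g q volume ∧
    ∀ ε : ℝ≥0∞, ε ≠ 0 → ∃ h ∈ haarSpan m, eLpNorm (g - h) q volume ≤ ε}
  zero_mem' := ⟨MemLp.zero', fun ε _ => ⟨0, zero_mem _, by simp⟩⟩
  add_mem' := by
    rintro f g ⟨hf, hf'⟩ ⟨hg, hg'⟩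
    refine ⟨hf.add hg, fun ε hε => ?_⟩
    obtain ⟨u, hu, hfu⟩ := hf' (ε / 2) (by simpa using hε)
    obtain ⟨v, hv, hgv⟩ := hg' (ε / 2) (by simpa using hε)
    refine ⟨u + v, add_mem hu hv, ?_⟩
    rw [add_sub_add_comm]
    refine (eLpNorm_add_le (hf.sub (memLp_of_mem_haarSpan hu q)).1
      (hg.sub (memLp_of_mem_haarSpan hv q)).1 hq).trans ?_
    exact (add_le_add hfu hgv).trans (ENNReal.add_halves ε).le
  smul_mem' := by
    rintro a f ⟨hf, hf'⟩
    refine ⟨hf.const_smul a, fun ε hε => ?_⟩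
    by_cases ha : a = 0
    · exact ⟨0, zero_mem _, by simp [ha]⟩
    obtain ⟨u, hu, hfu⟩ := hf' (ε / ‖a‖ₑ) (ENNReal.div_pos hε (by simp)).ne'
    refine ⟨a • u, Submodule.smul_mem _ a hu, ?_⟩
    rw [← smul_sub, eLpNorm_const_smul]
    exact (mul_le_mul_right hfu _).trans ENNReal.mul_div_le

theorem mem_haarClosure_of_approx {m : ℕ} {q : ℝ≥0∞} (hq : 1 ≤ q) {g : Space m → ℂ}
    (hg : MemLp g q volume)
    (h : ∀ ε : ℝ≥0∞, ε ≠ 0 → ∃ h ∈ haarClosure m q hq, eLpNorm (g - h) q volume ≤ ε) :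
    g ∈ haarClosure m q hq := by
  refine ⟨hg, fun ε hε => ?_⟩
  obtain ⟨u, hu, hgu⟩ := h (ε / 2) (by simpa using hε)
  obtain ⟨v, hv, huv⟩ := hu.2 (ε / 2) (by simpa using hε)
  refine ⟨v, hv, ?_⟩
  rw [← sub_add_sub_cancel g u v]
  refine (eLpNorm_add_le (hg.sub hu.1).1 (hu.1.sub (memLp_of_mem_haarSpan hv q)).1 hq).trans ?_
  exact (add_le_add hgu huv).trans (ENNReal.add_halves ε).le

theorem sum_walsh_mul {m : ℕ} (c c' : Fin m → Bool) :
    ∑ e, walsh e c * walsh e c' = if c = c' then (2 : ℝ) ^ m else 0 := by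
  have h := Finset.prod_univ_sum (fun _ : Fin m => (Finset.univ : Finset Bool))
    (fun j b => (if c j && b then (-1 : ℝ) else 1) * if c' j && b then -1 else 1)
  rw [Fintype.piFinset_univ] at h
  simp only [walsh, ← Finset.prod_mul_distrib]
  rw [← h]
  split_ifs with hc
  · subst hc
    rw [Finset.prod_congr rfl (g := fun _ => (2 : ℝ)) fun j _ => ?_]
    · simp
    · cases c j <;> norm_num
  · obtain ⟨j, hj⟩ := Function.ne_iff.1 hc
    refine Finset.prod_eq_zero (Finset.mem_univ j) ?_
    revert hj
    cases c j <;> cases c' j <;> simp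

/-- Orthogonality of the Walsh characters; the summand `1` is the trivial sign, which `Sign m`
excludes. -/
theorem sum_sign_walsh_mul {m : ℕ} (c c' : Fin m → Bool) :
    1 + ∑ e : Sign m, walsh e.1 c * walsh e.1 c' = if c = c' then (2 : ℝ) ^ m else 0 := by
  rw [← sum_walsh_mul, ← Fintype.sum_subtype_add_sum_subtype (fun e : Fin m → Bool =>
    ∃ j, e j = true), add_comm]
  congr 1
  have h0 : ∀ (e : {e : Fin m → Bool // ¬ ∃ j, e j = true}) (j : Fin m), e.1 j = false :=
    fun e j => by
      have := e.2
      push Not at this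
      simpa using this j
  have : Unique {e : Fin m → Bool // ¬ ∃ j, e j = true} :=
    { default := ⟨fun _ => false, by simp⟩
      uniq := fun e => Subtype.ext (funext fun j => h0 e j) }
  rw [Fintype.sum_unique]
  simp [h0, walsh]

/-- The indicator function of a child in terms of the Haar functions of the parent. -/
theorem indicator_child {m : ℕ} (I : DyadicCube m) (c : Fin m → Bool) :
    (I.child c).toSet.indicator (1 : (Fin m → ℝ) → ℝ) =
      ((2 : ℝ) ^ m)⁻¹ • I.toSet.indicator 1 +
        ∑ e : Sign m, (((2 : ℝ) ^ m)⁻¹ * Real.sqrt I.vol * walsh e.1 c) • haarCube I e := by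
  ext x
  simp only [Pi.add_apply, Pi.smul_apply, Finset.sum_apply, smul_eq_mul]
  by_cases hx : x ∈ I.toSet
  · have hx' := hx
    rw [iUnion_child] at hx'
    obtain ⟨c', hc'⟩ := Set.mem_iUnion.1 hx'
    have h1 : (I.child c).toSet.indicator (1 : (Fin m → ℝ) → ℝ) x = if c = c' then 1 else 0 := by
      classical
      rw [mem_child_iff] at hc'
      rw [Set.indicator_apply, mem_child_iff, ← hc'.2]
      simp [hx]
    have h2 : Real.sqrt I.vol ≠ 0 := (Real.sqrt_pos.2 (vol_pos I)).ne'
    have h3 : ∑ e : Sign m, ((2 : ℝ) ^ m)⁻¹ * Real.sqrt I.vol * walsh e.1 c * haarCube I e x =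
        ((2 : ℝ) ^ m)⁻¹ * ∑ e : Sign m, walsh e.1 c * walsh e.1 c' := by
      rw [Finset.mul_sum]
      refine Finset.sum_congr rfl fun e _ => ?_
      rw [haarCube_child I e c' hc']
      field_simp
    rw [h1, h3, Set.indicator_of_mem hx, Pi.one_apply, ← mul_add, sum_sign_walsh_mul]
    split_ifs <;> simp
  · rw [Set.indicator_of_notMem hx, Set.indicator_of_notMem fun h => hx (child_toSet_subset I c h)]
    simp [haarCube_eq_zero I _ hx]

theorem exists_eq_child {m : ℕ} (I : DyadicCube m) : ∃ J c, I = DyadicCube.child J c := by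
  refine ⟨⟨I.scale - 1, fun j => I.pos j / 2⟩, fun j => decide (I.pos j % 2 = 1), ?_⟩
  rw [DyadicCube.ext_iff']
  simp only [DyadicCube.child, sub_add_cancel, true_and, decide_eq_true_eq]
  intro j
  split_ifs <;> omega

/-- Iterates `indicator_child` up `n` generations. The linear map `Φ` lets the same argument serve
for tensoring in either variable. -/
theorem exists_ancestor {m : ℕ} {M : Type*} [AddCommGroup M] [Module ℝ M]
    (Φ : ((Fin m → ℝ) → ℝ) →ₗ[ℝ] M) (W : Submodule ℝ M)
    (hΦ : ∀ I e, Φ (haarCube I e) ∈ W) (n : ℕ) : ∀ I : DyadicCube m, ∃ J : DyadicCube m, ∃ w ∈ W,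
      J.vol = (2 ^ m) ^ n * I.vol ∧
        Φ (I.toSet.indicator 1) = (((2 : ℝ) ^ m) ^ n)⁻¹ • Φ (J.toSet.indicator 1) + w := by
  induction n with
  | zero => exact fun I => ⟨I, 0, zero_mem _, by simp, by simp⟩
  | succ n ih =>
    intro I
    obtain ⟨J, c, rfl⟩ := exists_eq_child I
    obtain ⟨J', w, hw, hJ', h⟩ := ih J
    refine ⟨J', ((2 : ℝ) ^ m)⁻¹ • w + ∑ e : Sign m, (((2 : ℝ) ^ m)⁻¹ * Real.sqrt J.vol *
      walsh e.1 c) • Φ (haarCube J e), add_mem (W.smul_mem _ hw)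
        (sum_mem fun e _ => W.smul_mem _ (hΦ J e)), ?_, ?_⟩
    · rw [hJ', vol_child]; field_simp; ring
    · rw [indicator_child, map_add, map_smul, h, map_sum, smul_add, smul_smul, add_assoc,
        ← mul_inv, ← pow_succ']
      simp only [map_smul]

/-- The ancestor term has norm at most a constant times `θ ^ n`, where `θ` is `2 ^ m` to the power
`1 / q - 1`. Both `m ≥ 1` and `q > 1` are needed for `θ < 1`. -/
theorem map_indicator_mem_haarClosure {m : ℕ} (hm : 1 ≤ m) {q : ℝ≥0∞} (hq : 1 < q) (hq' : q < ∞)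
    (Φ : ((Fin m → ℝ) → ℝ) →ₗ[ℝ] (Space m → ℂ))
    (hΦ : ∀ I e, Φ (haarCube I e) ∈ haarClosure m q hq.le) {C : ℝ}
    (hmem : ∀ I : DyadicCube m, MemLp (Φ (I.toSet.indicator 1)) q volume)
    (hC : ∀ I : DyadicCube m,
      eLpNorm (Φ (I.toSet.indicator 1)) q volume ≤ ENNReal.ofReal (C * I.vol ^ (1 / q.toReal)))
    (I : DyadicCube m) : Φ (I.toSet.indicator 1) ∈ haarClosure m q hq.le := by
  refine mem_haarClosure_of_approx hq.le (hmem I) fun ε hε => ?_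
  have hq1 : 1 < q.toReal := by
    rw [← ENNReal.toReal_one]; exact (ENNReal.toReal_lt_toReal (by simp) hq'.ne).2 hq
  set θ : ℝ := ((2 : ℝ) ^ m)⁻¹ * ((2 : ℝ) ^ m) ^ (1 / q.toReal) with hθ
  have h2m : (1 : ℝ) < 2 ^ m := one_lt_pow₀ (by norm_num) (by omega)
  have hθ1 : θ < 1 := by
    have : ((2 : ℝ) ^ m) ^ (1 / q.toReal) < (2 : ℝ) ^ m := by
      conv_rhs => rw [← Real.rpow_one ((2 : ℝ) ^ m)]
      exact Real.rpow_lt_rpow_of_exponent_lt h2m (by rw [div_lt_one (by linarith)]; exact hq1)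
    rw [hθ, inv_mul_lt_iff₀ (by positivity), mul_one]; exact this
  have hlim : Filter.Tendsto (fun n : ℕ => ENNReal.ofReal (θ ^ n * (C * I.vol ^ (1 / q.toReal))))
      Filter.atTop (nhds 0) := by
    rw [← ENNReal.ofReal_zero]
    refine (ENNReal.continuous_ofReal.tendsto 0).comp ?_
    rw [← zero_mul (C * I.vol ^ (1 / q.toReal))]
    exact (tendsto_pow_atTop_nhds_zero_of_lt_one (by positivity) hθ1).mul_const _
  obtain ⟨n, hn⟩ := (hlim.eventually (eventually_lt_nhds (pos_iff_ne_zero.2 hε))).exists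
  obtain ⟨J, w, hw, hJ, h⟩ := exists_ancestor Φ ((haarClosure m q hq.le).restrictScalars ℝ) hΦ n I
  refine ⟨w, hw, ?_⟩
  rw [h, add_sub_cancel_right, eLpNorm_const_smul]
  refine ((mul_le_mul_right (hC J) _).trans_eq ?_).trans hn.le
  rw [← ofReal_norm, ← ENNReal.ofReal_mul (norm_nonneg _), Real.norm_of_nonneg (by positivity), hJ,
    Real.mul_rpow (by positivity) (vol_pos I).le, hθ, mul_pow, ← Real.rpow_natCast (_ ^ (1 / _)),
    ← Real.rpow_mul (by positivity), mul_comm (1 / q.toReal), Real.rpow_mul (by positivity),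
    Real.rpow_natCast, inv_pow]
  congr 1
  ring

theorem eLpNorm_tensor {m : ℕ} {q : ℝ≥0∞} (hq : q ≠ 0) (hq' : q ≠ ∞) {u v : (Fin m → ℝ) → ℝ}
    (hu : Measurable u) (hv : Measurable v) :
    eLpNorm (fun x : Space m => ((u x.1 * v x.2 : ℝ) : ℂ)) q volume =
      eLpNorm u q volume * eLpNorm v q volume := by
  have hr : 0 < q.toReal := ENNReal.toReal_pos hq hq'
  simp only [eLpNorm_eq_lintegral_rpow_enorm_toReal hq hq']
  rw [← ENNReal.mul_rpow_of_nonneg _ _ (by positivity), ← lintegral_prod_mul,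
    ← Measure.volume_eq_prod]
  · congr 1
    refine lintegral_congr fun x => ?_
    rw [← ENNReal.mul_rpow_of_nonneg _ _ hr.le, ← enorm_mul, ← ofReal_norm, Complex.norm_real,
      ofReal_norm]
  · exact (hu.enorm.pow_const _).aemeasurable
  · exact (hv.enorm.pow_const _).aemeasurable

theorem measurable_indicator_toSet {m : ℕ} (I : DyadicCube m) :
    Measurable (I.toSet.indicator (1 : (Fin m → ℝ) → ℝ)) :=
  measurable_const.indicator (measurableSet_toSet I)

theorem eLpNorm_indicator_toSet {m : ℕ} {q : ℝ≥0∞} (hq : q ≠ 0) (hq' : q ≠ ∞) (I : DyadicCube m) :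
    eLpNorm (I.toSet.indicator (1 : (Fin m → ℝ) → ℝ)) q volume =
      ENNReal.ofReal (I.vol ^ (1 / q.toReal)) := by
  rw [show (1 : (Fin m → ℝ) → ℝ) = fun _ => 1 from rfl,
    eLpNorm_indicator_const (measurableSet_toSet I) hq hq', volume_toSet, enorm_one, one_mul,
    ENNReal.ofReal_rpow_of_nonneg (by positivity) (by positivity)]
  rfl

theorem memLp_tensor {m : ℕ} {q : ℝ≥0∞} (hq : q ≠ 0) (hq' : q ≠ ∞) {u v : (Fin m → ℝ) → ℝ}
    (hu : Measurable u) (hv : Measurable v) (hu' : eLpNorm u q volume < ∞)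
    (hv' : eLpNorm v q volume < ∞) :
    MemLp (fun x : Space m => ((u x.1 * v x.2 : ℝ) : ℂ)) q volume :=
  ⟨(Complex.measurable_ofReal.comp ((hu.comp measurable_fst).mul
    (hv.comp measurable_snd))).aestronglyMeasurable, by
      rw [eLpNorm_tensor hq hq' hu hv]; exact ENNReal.mul_lt_top hu' hv'⟩

/-- Tensor multiplication by a fixed function in the second variable. -/
noncomputable def tensorRight {m : ℕ} (v : (Fin m → ℝ) → ℝ) :
    ((Fin m → ℝ) → ℝ) →ₗ[ℝ] (Space m → ℂ) where
  toFun u := fun x => ((u x.1 * v x.2 : ℝ) : ℂ)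
  map_add' u u' := by ext x; simp [add_mul]
  map_smul' a u := by ext x; simp [mul_assoc]

/-- Tensor multiplication by a fixed function in the first variable. -/
noncomputable def tensorLeft {m : ℕ} (u : (Fin m → ℝ) → ℝ) :
    ((Fin m → ℝ) → ℝ) →ₗ[ℝ] (Space m → ℂ) where
  toFun v := fun x => ((u x.1 * v x.2 : ℝ) : ℂ)
  map_add' v v' := by ext x; simp [mul_add]
  map_smul' a v := by ext x; simp [mul_left_comm]

theorem B₁_mem_haarClosure {m : ℕ} {q : ℝ≥0∞} (hq : 1 ≤ q) (r : Index m) :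
    (fun x => (B₁ r x : ℂ)) ∈ haarClosure m q hq :=
  ⟨(memLp_B₁ r q).ofReal, fun ε _ => ⟨_, Submodule.subset_span ⟨r, rfl⟩, by simp⟩⟩

theorem indicator_prod_mem_haarClosure {m : ℕ} (hm : 1 ≤ m) {q : ℝ≥0∞} (hq : 1 < q) (hq' : q < ∞)
    (I J : DyadicCube m) :
    (fun x : Space m => ((I.toSet.indicator 1 x.1 * J.toSet.indicator 1 x.2 : ℝ) : ℂ)) ∈
      haarClosure m q hq.le := by
  have hq0 : q ≠ 0 := (zero_lt_one.trans hq).ne'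
  have hfin : ∀ I : DyadicCube m,
      eLpNorm (I.toSet.indicator (1 : (Fin m → ℝ) → ℝ)) q volume < ∞ := fun I => by
    rw [eLpNorm_indicator_toSet hq0 hq'.ne]; exact ENNReal.ofReal_lt_top
  -- One variable at a time: Haar functions in the first variable are replaced by indicators with a
  -- Haar function kept in the second, and then the second variable is treated.
  have h1 : ∀ (J : DyadicCube m) (e : Sign m) (I : DyadicCube m),
      tensorRight (haarCube J e) (I.toSet.indicator 1) ∈ haarClosure m q hq.le := fun J e => by
    have hJ := (memLp_haarCube J e q).2
    refine map_indicator_mem_haarClosure (C := (eLpNorm (haarCube J e) q volume).toReal) hm hq hq' _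
      (fun I e' => B₁_mem_haarClosure hq.le ((I, J), (e', e))) (fun I => ?_) (fun I => ?_)
    · exact memLp_tensor hq0 hq'.ne (measurable_indicator_toSet I) (measurable_haarCube J e)
        (hfin I) hJ
    · refine (eLpNorm_tensor hq0 hq'.ne (measurable_indicator_toSet I)
        (measurable_haarCube J e)).le.trans_eq ?_
      rw [ENNReal.ofReal_mul ENNReal.toReal_nonneg, ENNReal.ofReal_toReal hJ.ne,
        eLpNorm_indicator_toSet hq0 hq'.ne, mul_comm]
  refine map_indicator_mem_haarClosure (C := I.vol ^ (1 / q.toReal)) hm hq hq'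
    (tensorLeft (I.toSet.indicator 1)) (fun J e => h1 J e I) (fun J => ?_) (fun J => ?_) J
  · exact memLp_tensor hq0 hq'.ne (measurable_indicator_toSet I) (measurable_indicator_toSet J)
      (hfin I) (hfin J)
  · refine (eLpNorm_tensor hq0 hq'.ne (measurable_indicator_toSet I)
      (measurable_indicator_toSet J)).le.trans_eq ?_
    have := (vol_pos I).le
    rw [ENNReal.ofReal_mul (by positivity), eLpNorm_indicator_toSet hq0 hq'.ne,
      eLpNorm_indicator_toSet hq0 hq'.ne]

/-- The lower corner of the dyadic cube of scale `k` around `x`. -/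
noncomputable def corner {m : ℕ} (k : ℤ) (n : Fin m → ℤ) : Fin m → ℝ := fun j => n j * 2 ^ (-k)

theorem dist_corner_le {m : ℕ} (k : ℤ) (x : Fin m → ℝ) :
    dist x (corner k (cubeAt k x).pos) ≤ 2 ^ (-k) := by
  refine (dist_pi_le_iff (by positivity)).2 fun j => ?_
  have h := mem_cubeAt k x j
  simp only [Set.mem_Ico, cubeAt] at h
  rw [Real.dist_eq, abs_le]
  simp only [corner, cubeAt]
  constructor <;> nlinarith [h.1, h.2, zpow_pos (two_pos : (0 : ℝ) < 2) (-k)]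

theorem step_mem_haarClosure {m : ℕ} (hm : 1 ≤ m) {q : ℝ≥0∞} (hq : 1 < q) (hq' : q < ∞)
    (k : ℤ) {g : Space m → ℂ} (hg : HasCompactSupport g) :
    (fun x : Space m => g (corner k (cubeAt k x.1).pos, corner k (cubeAt k x.2).pos)) ∈
      haarClosure m q hq.le := by
  classical
  obtain ⟨R, hR⟩ := hg.isBounded.subset_closedBall (0 : Space m)
  obtain ⟨M, hM⟩ := exists_nat_gt (R * 2 ^ k)
  -- Compact support leaves only finitely many nonzero values, so the step function is a finite
  -- combination of indicators of products of cubes.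
  have hbox : ∀ n n' : Fin m → ℤ, g (corner k n, corner k n') ≠ 0 →
      n ∈ Fintype.piFinset (fun _ : Fin m => Finset.Icc (-(M : ℤ)) M) ∧
      n' ∈ Fintype.piFinset (fun _ : Fin m => Finset.Icc (-(M : ℤ)) M) := by
    intro n n' h
    have h1 : ‖((corner k n, corner k n') : Space m)‖ ≤ R := by
      simpa using hR (subset_tsupport g h)
    have h2 : ∀ n : Fin m → ℤ, ‖corner k n‖ ≤ R →
        n ∈ Fintype.piFinset (fun _ : Fin m => Finset.Icc (-(M : ℤ)) M) := fun n hn => by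
      rw [Fintype.mem_piFinset]
      intro j
      have h3 := (norm_le_pi_norm (corner k n) j).trans hn
      rw [corner, norm_mul, Real.norm_of_nonneg (by positivity : (0 : ℝ) ≤ 2 ^ (-k)), zpow_neg,
        ← div_eq_mul_inv, div_le_iff₀ (by positivity), Real.norm_eq_abs] at h3
      have h4 : |(n j : ℝ)| < M := h3.trans_lt hM
      rw [← Int.cast_abs] at h4
      have h5 : |n j| < M := by exact_mod_cast h4
      rw [Finset.mem_Icc]
      have := abs_lt.1 h5
      constructor <;> linarith [this.1, this.2]
    exact ⟨h2 n ((le_max_left _ _).trans h1), h2 n' ((le_max_right _ _).trans h1)⟩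
  set s := Fintype.piFinset (fun _ : Fin m => Finset.Icc (-(M : ℤ)) M)
  have h : (fun x : Space m => g (corner k (cubeAt k x.1).pos, corner k (cubeAt k x.2).pos)) =
      ∑ z ∈ s ×ˢ s, g (corner k z.1, corner k z.2) • fun x : Space m =>
        (((⟨k, z.1⟩ : DyadicCube m).toSet.indicator 1 x.1 *
          (⟨k, z.2⟩ : DyadicCube m).toSet.indicator 1 x.2 : ℝ) : ℂ) := by
    ext x
    have hind : ∀ (n : Fin m → ℤ) (y : Fin m → ℝ),
        (⟨k, n⟩ : DyadicCube m).toSet.indicator (1 : (Fin m → ℝ) → ℝ) y =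
          if (cubeAt k y).pos = n then 1 else 0 := fun n y => by
      rw [Set.indicator_apply, mem_toSet_iff]
      simp only [cubeAt, DyadicCube.mk.injEq, true_and, Pi.one_apply]
      congr
    simp only [Finset.sum_apply, Pi.smul_apply, hind, smul_eq_mul]
    by_cases hx : ((cubeAt k x.1).pos, (cubeAt k x.2).pos) ∈ s ×ˢ s
    · rw [Finset.sum_eq_single_of_mem _ hx]
      · simp
      · intro z _ hz
        have : ¬ ((cubeAt k x.1).pos = z.1 ∧ (cubeAt k x.2).pos = z.2) := fun h =>
          hz (Prod.ext h.1.symm h.2.symm)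
        rw [not_and_or] at this
        rcases this with h | h <;> simp [h]
    · rw [Finset.sum_eq_zero]
      · by_contra h0
        exact hx (Finset.mem_product.2 (hbox _ _ h0))
      · intro z hz
        have : ¬ ((cubeAt k x.1).pos = z.1 ∧ (cubeAt k x.2).pos = z.2) := fun h =>
          hx (by rw [h.1, h.2]; exact hz)
        rw [not_and_or] at this
        rcases this with h | h <;> simp [h]
  rw [h]
  exact sum_mem fun z _ => Submodule.smul_mem _ _ (indicator_prod_mem_haarClosure hm hq hq' _ _)

theorem mem_haarClosure_of_continuous {m : ℕ} (hm : 1 ≤ m) {q : ℝ≥0∞} (hq : 1 < q) (hq' : q < ∞)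
    {g : Space m → ℂ} (hg : HasCompactSupport g) (hgc : Continuous g) (hgq : MemLp g q volume) :
    g ∈ haarClosure m q hq.le := by
  refine mem_haarClosure_of_approx hq.le hgq fun ε hε => ?_
  obtain ⟨R, hR⟩ := hg.isBounded.subset_closedBall (0 : Space m)
  set B := Metric.closedBall (0 : Space m) (R + 1)
  have hB : volume B ^ (1 / q.toReal) ≠ ∞ :=
    ENNReal.rpow_ne_top_of_nonneg (by positivity) measure_closedBall_lt_top.ne
  obtain ⟨δ, hδ, hδε⟩ : ∃ δ : ℝ, 0 < δ ∧
      ENNReal.ofReal δ * volume B ^ (1 / q.toReal) ≤ ε := by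
    have h1 : Filter.Tendsto (fun δ : ℝ => ENNReal.ofReal δ * volume B ^ (1 / q.toReal))
        (nhdsWithin 0 (Set.Ioi 0)) (nhds 0) := by
      rw [← zero_mul (volume B ^ (1 / q.toReal)), ← ENNReal.ofReal_zero]
      refine ENNReal.Tendsto.mul_const ?_ (Or.inr hB)
      exact (ENNReal.continuous_ofReal.tendsto 0).mono_left nhdsWithin_le_nhds
    obtain ⟨δ, h2, h3⟩ := ((h1.eventually (eventually_lt_nhds (pos_iff_ne_zero.2 hε))).and
      self_mem_nhdsWithin).exists
    exact ⟨δ, h3, h2.le⟩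
  obtain ⟨η, hη, hgη⟩ := Metric.uniformContinuous_iff.1
    (hg.uniformContinuous_of_continuous hgc) δ hδ
  -- Mesh below `η` for uniform continuity, and below `1` so that the step function stays supported
  -- in the ball of radius `R + 1`.
  obtain ⟨k, hk⟩ := exists_pow_lt_of_lt_one (lt_min hη one_pos) (by norm_num : (1 / 2 : ℝ) < 1)
  have hk' : (2 : ℝ) ^ (-(k : ℤ)) = (1 / 2) ^ k := by simp
  have hdist : ∀ x : Space m, dist x (corner k (cubeAt k x.1).pos, corner k (cubeAt k x.2).pos) <
      min η 1 := fun x => by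
    refine lt_of_le_of_lt (max_le ?_ ?_) (hk'.trans_lt hk)
    · exact dist_corner_le _ _
    · exact dist_corner_le _ _
  refine ⟨_, step_mem_haarClosure hm hq hq' k hg, le_trans ?_ hδε⟩
  refine eLpNorm_sub_le_of_dist_bdd volume hq'.ne Metric.isClosed_closedBall.measurableSet hδ.le
    (fun x => ((hgη ((hdist x).trans_le (min_le_left _ _))).le)) ?_ ?_
  · exact (subset_tsupport g).trans (hR.trans (Metric.closedBall_subset_closedBall (by linarith)))
  · intro x hx
    have h1 := hR (subset_tsupport g hx)
    have h2 := (hdist x).trans_le (min_le_right _ _)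
    rw [Metric.mem_closedBall] at h1 ⊢
    linarith [dist_triangle x (corner k (cubeAt k x.1).pos, corner k (cubeAt k x.2).pos) 0]

theorem exists_mem_haarSpan_eLpNorm_sub_le {m : ℕ} (hm : 1 ≤ m) {q : ℝ≥0∞} (hq : 1 < q)
    (hq' : q < ∞) {g : Space m → ℂ} (hg : MemLp g q volume) {ε : ℝ≥0∞} (hε : ε ≠ 0) :
    ∃ h ∈ haarSpan m, eLpNorm (g - h) q volume ≤ ε := by
  suffices g ∈ haarClosure m q hq.le from this.2 ε hε
  refine mem_haarClosure_of_approx hq.le hg fun ε hε => ?_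
  have : (volume : Measure (Space m)).Regular :=
    Measure.Regular.of_sigmaCompactSpace_of_isLocallyFiniteMeasure _
  obtain ⟨u, hu, hgu, huc, huq⟩ := hg.exists_hasCompactSupport_eLpNorm_sub_le hq'.ne hε
  exact ⟨u, mem_haarClosure_of_continuous hm hq hq' hu huc huq, hgu⟩

/-! ### The lower bound -/

section Lower

variable {m : ℕ} {p : ℝ≥0∞}

theorem integral_sum_mul_B₁ (s : Finset (Index m)) (b : Index m → ℂ) {r : Index m} (hr : r ∈ s) :
    ∫ x, (∑ i ∈ s, b i * (B₁ i x : ℂ)) * (B₁ r x : ℂ) = b r := by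
  classical
  have h1 : ∀ i, Integrable fun x => (B₁ i x : ℂ) * (B₁ r x : ℂ) := fun i =>
    integrable_mul_B₁ le_rfl (memLp_B₁ i 1).ofReal r
  have h2 : ∀ i, ∫ x, (B₁ i x : ℂ) * (B₁ r x : ℂ) = if i = r then 1 else 0 := fun i => by
    simp only [← Complex.ofReal_mul, integral_complex_ofReal]
    split_ifs with h
    · rw [h, integral_B₁_mul_self, Complex.ofReal_one]
    · rw [integral_B₁_mul_of_ne h, Complex.ofReal_zero]
  simp only [Finset.sum_mul, mul_assoc]
  rw [integral_finsetSum _ fun i _ => (h1 i).const_mul _]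
  simp only [integral_const_mul, h2]
  simp [hr]

theorem lintegral_enorm_B₁_sq (r : Index m) : ∫⁻ x, ‖B₁ r x‖ₑ ^ 2 = 1 := by
  have h1 : ∀ x, ‖B₁ r x‖ₑ ^ 2 = ENNReal.ofReal (B₁ r x * B₁ r x) := fun x => by
    rw [← ofReal_norm, ← ENNReal.ofReal_pow (norm_nonneg _), Real.norm_eq_abs, sq_abs, sq]
  have h2 : Integrable fun x => B₁ r x * B₁ r x := (memLp_B₁ r 2).integrable_mul (memLp_B₁ r 2)
  simp only [h1]
  rw [← ofReal_integral_eq_lintegral_ofReal h2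
    (Filter.Eventually.of_forall fun x => mul_self_nonneg _), integral_B₁_mul_self,
    ENNReal.ofReal_one]

theorem sum_mul_le_squareFunction_mul (s : Finset (Index m)) (f g : Space m → ℂ) (x : Space m) :
    ∑ r ∈ s, ‖∫ y, f y * (B₁ r y : ℂ)‖ₑ * ‖∫ y, g y * (B₁ r y : ℂ)‖ₑ * ‖B₁ r x‖ₑ ^ 2 ≤
      squareFunction B₁ f x * squareFunction B₁ g x := by
  have h1 : ∀ f : Space m → ℂ, (∑ r ∈ s, (‖∫ y, f y * (B₁ r y : ℂ)‖ₑ * ‖B₁ r x‖ₑ) ^ (2 : ℝ)) ^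
      (1 / 2 : ℝ) ≤ squareFunction B₁ f x := fun f => by
    have := squareFunction_rpow B₁ f x 1
    rw [ENNReal.rpow_one] at this
    rw [this]
    refine ENNReal.rpow_le_rpow (le_trans (le_of_eq ?_) (ENNReal.sum_le_tsum s)) (by positivity)
    refine Finset.sum_congr rfl fun r _ => ?_
    rw [ENNReal.rpow_two, mul_pow]
  refine le_trans (le_of_eq ?_) ((ENNReal.inner_le_Lp_mul_Lq s _ _
    (Real.HolderConjugate.two_two)).trans (mul_le_mul' (h1 f) (h1 g)))
  exact Finset.sum_congr rfl fun r _ => by ring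

/-- Orthonormality expands the pairing into products of coefficients; inserting the unit integral of
each `‖B₁ r‖ₑ ^ 2` allows Cauchy–Schwarz pointwise under the integral. -/
theorem enorm_integral_mul_haarSpan_le (hp : 1 ≤ p) {f g : Space m → ℂ} (hf : MemLp f p volume)
    (hg : g ∈ haarSpan m) :
    ‖∫ x, f x * g x‖ₑ ≤ ∫⁻ x, squareFunction B₁ f x * squareFunction B₁ g x := by
  obtain ⟨b, rfl⟩ := Finsupp.mem_span_range_iff_exists_finsupp.1 hg
  have hb : (b.sum fun i a => a • fun x => (B₁ i x : ℂ)) =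
      fun x => ∑ i ∈ b.support, b i * (B₁ i x : ℂ) := by
    ext x
    simp [Finsupp.sum, Finset.sum_apply]
  rw [hb]
  have hint := integrable_mul_B₁ hp hf
  have h1 : ∫ x, f x * ∑ i ∈ b.support, b i * (B₁ i x : ℂ) =
      ∑ i ∈ b.support, b i * ∫ x, f x * (B₁ i x : ℂ) := by
    simp only [Finset.mul_sum, mul_left_comm (f _)]
    rw [integral_finsetSum _ fun i _ => (hint i).const_mul _]
    simp only [integral_const_mul]
  calc _ ≤ ∑ r ∈ b.support, ‖∫ x, f x * (B₁ r x : ℂ)‖ₑ *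
        ‖∫ x, (∑ i ∈ b.support, b i * (B₁ i x : ℂ)) * (B₁ r x : ℂ)‖ₑ := by
        rw [h1]
        refine (enorm_sum_le _ _).trans (Finset.sum_le_sum fun r hr => ?_)
        rw [enorm_mul, integral_sum_mul_B₁ _ _ hr, mul_comm]
    _ = ∫⁻ y, ∑ r ∈ b.support, ‖∫ x, f x * (B₁ r x : ℂ)‖ₑ *
        ‖∫ x, (∑ i ∈ b.support, b i * (B₁ i x : ℂ)) * (B₁ r x : ℂ)‖ₑ * ‖B₁ r y‖ₑ ^ 2 := by
        rw [lintegral_finsetSum _ fun r _ => by fun_prop]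
        refine Finset.sum_congr rfl fun r _ => ?_
        rw [lintegral_const_mul _ (by fun_prop), lintegral_enorm_B₁_sq, mul_one]
    _ ≤ _ := lintegral_mono fun x => sum_mul_le_squareFunction_mul _ _ _ _

theorem one_lt_toReal {p : ℝ≥0∞} (hp : 1 < p) (hp' : p < ∞) : 1 < p.toReal := by
  rw [← ENNReal.toReal_one]; exact (ENNReal.toReal_lt_toReal (by simp) hp'.ne).2 hp

theorem eLpNorm_squareFunction_B₁_le (m : ℕ) {p : ℝ≥0∞} (hp : 1 < p) (hp' : p < ∞) :
    ∃ C : ℝ≥0∞, C ≠ ∞ ∧ ∀ f : Space m → ℂ, MemLp f p volume →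
      eLpNorm (squareFunction B₁ f) p volume ≤ C * eLpNorm f p volume := by
  have hp1 := one_lt_toReal hp hp'
  have hp0 : p ≠ 0 := (zero_lt_one.trans hp).ne'
  obtain ⟨K, hK, h⟩ := lintegral_squareFunction_B₁_le m hp1
  refine ⟨K ^ (1 / p.toReal), ENNReal.rpow_ne_top_of_nonneg (by positivity) hK, fun f hf => ?_⟩
  rw [eLpNorm_eq_lintegral_rpow_enorm_toReal hp0 hp'.ne,
    eLpNorm_eq_lintegral_rpow_enorm_toReal hp0 hp'.ne,
    ← ENNReal.mul_rpow_of_nonneg _ _ (by positivity)]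
  refine ENNReal.rpow_le_rpow ?_ (by positivity)
  simp only [enorm_eq_self]
  exact h f (by rwa [ENNReal.ofReal_toReal hp'.ne])

theorem lintegral_mul_squareFunction_le {q : ℝ≥0∞} [hpq : ENNReal.HolderConjugate p q]
    (hp : 1 < p) (hp' : p < ∞) (hq' : q < ∞) (f g : Space m → ℂ) :
    ∫⁻ x, squareFunction B₁ f x * squareFunction B₁ g x ≤
      eLpNorm (squareFunction B₁ f) p volume * eLpNorm (squareFunction B₁ g) q volume := by
  have hq0 : q ≠ 0 := ENNReal.HolderConjugate.ne_zero q p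
  rw [eLpNorm_eq_lintegral_rpow_enorm_toReal (zero_lt_one.trans hp).ne' hp'.ne,
    eLpNorm_eq_lintegral_rpow_enorm_toReal hq0 hq'.ne]
  simp only [enorm_eq_self]
  refine ENNReal.lintegral_mul_le_Lp_mul_Lq volume ?_ (by fun_prop) (by fun_prop)
  exact ENNReal.HolderConjugate.toReal (one_lt_toReal hp hp')

/-- Density extends the bilinear estimate from Haar combinations to all of `L^q`. Finiteness of
`hSf` is needed to let the error tend to zero. -/
theorem enorm_integral_mul_le {q : ℝ≥0∞} [hpq : ENNReal.HolderConjugate p q] (hm : 1 ≤ m)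
    (hp : 1 < p) (hp' : p < ∞) (hq : 1 < q) (hq' : q < ∞) {C : ℝ≥0∞} (hCtop : C ≠ ∞)
    (hC : ∀ g : Space m → ℂ, MemLp g q volume →
      eLpNorm (squareFunction B₁ g) q volume ≤ C * eLpNorm g q volume)
    {f g : Space m → ℂ} (hf : MemLp f p volume) (hSf : eLpNorm (squareFunction B₁ f) p volume ≠ ∞)
    (hg : MemLp g q volume) :
    ‖∫ x, f x * g x‖ₑ ≤ eLpNorm (squareFunction B₁ f) p volume * (C * eLpNorm g q volume) := by
  set A := eLpNorm (squareFunction B₁ f) p volume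
  have h1 : ∀ ε : ℝ≥0∞, ε ≠ 0 → ‖∫ x, f x * g x‖ₑ ≤
      eLpNorm f p volume * ε + A * (C * (eLpNorm g q volume + ε)) := fun ε hε => by
    obtain ⟨h, hh, hgh⟩ := exists_mem_haarSpan_eLpNorm_sub_le hm hq hq' hg hε
    have hhq := memLp_of_mem_haarSpan hh q
    have e1 : ∫ x, f x * g x = (∫ x, f x * (g - h) x) + ∫ x, f x * h x := by
      have i1 : Integrable fun x => f x * (g - h) x := hf.integrable_mul (hg.sub hhq)
      have i2 : Integrable fun x => f x * h x := hf.integrable_mul hhq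
      rw [← integral_add i1 i2]
      refine integral_congr_ae (Filter.Eventually.of_forall fun x => ?_)
      simp only [Pi.sub_apply]; ring
    rw [e1]
    refine (enorm_add_le _ _).trans (add_le_add ?_ ?_)
    · refine (enorm_integral_le_lintegral_enorm _).trans ?_
      have := eLpNorm_smul_le_mul_eLpNorm (p := p) (q := q) (r := 1) (hg.sub hhq).1 hf.1
      rw [eLpNorm_one_eq_lintegral_enorm] at this
      exact this.trans (mul_le_mul_right hgh _)
    · refine (enorm_integral_mul_haarSpan_le hp.le hf hh).trans
        ((lintegral_mul_squareFunction_le hp hp' hq' f h).trans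
          (mul_le_mul_right ((hC h hhq).trans (mul_le_mul_right ?_ _)) _))
      have e2 : h = g - (g - h) := by abel
      calc eLpNorm h q volume = eLpNorm (g - (g - h)) q volume := by rw [← e2]
        _ ≤ eLpNorm g q volume + eLpNorm (g - h) q volume :=
          eLpNorm_sub_le hg.1 (hg.sub hhq).1 hq.le
        _ ≤ _ := add_le_add_right hgh _
  have h2 : Filter.Tendsto (fun ε : ℝ≥0∞ => eLpNorm f p volume * ε +
      A * (C * (eLpNorm g q volume + ε))) (nhdsWithin 0 {0}ᶜ)
      (nhds (eLpNorm f p volume * 0 + A * (C * (eLpNorm g q volume + 0)))) := by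
    refine Filter.Tendsto.mono_left ?_ nhdsWithin_le_nhds
    refine (ENNReal.Tendsto.const_mul Filter.tendsto_id (Or.inr hf.2.ne)).add
      (ENNReal.Tendsto.const_mul (ENNReal.Tendsto.const_mul
        (tendsto_const_nhds.add Filter.tendsto_id) (Or.inr hCtop)) (Or.inr hSf))
  have h3 := ge_of_tendsto h2 (Filter.eventually_of_mem self_mem_nhdsWithin h1)
  simpa using h3

theorem eLpNorm_le_squareFunction_B₁ (hm : 1 ≤ m) (hp : 1 < p) (hp' : p < ∞) :
    ∃ C : ℝ≥0∞, C ≠ ∞ ∧ ∀ f : Space m → ℂ, MemLp f p volume →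
      eLpNorm f p volume ≤ C * eLpNorm (squareFunction B₁ f) p volume := by
  obtain ⟨q, hq⟩ : ∃ q, q = ENNReal.conjExponent p := ⟨_, rfl⟩
  have hpq : ENNReal.HolderConjugate p q := hq ▸ ENNReal.HolderConjugate.conjExponent hp.le
  have hq1 : 1 < q := (ENNReal.HolderConjugate.lt_top_iff_one_lt p q).1 hp'
  have hqtop : q < ∞ := (ENNReal.HolderConjugate.lt_top_iff_one_lt q p).2 hp
  obtain ⟨C₁, hC₁, h₁⟩ := eLpNorm_squareFunction_B₁_le m hp hp'
  obtain ⟨C, hC, h⟩ := eLpNorm_squareFunction_B₁_le m hq1 hqtop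
  refine ⟨C, hC, fun f hf => ?_⟩
  have hp0 : p ≠ 0 := (zero_lt_one.trans hp).ne'
  have hq0 : q ≠ 0 := (zero_lt_one.trans hq1).ne'
  have hpr := one_lt_toReal hp hp'
  have hqr := one_lt_toReal hq1 hqtop
  have hconj : p.toReal.HolderConjugate q.toReal :=
    ENNReal.HolderConjugate.toReal hpr
  set N := ∫⁻ x, ‖f x‖ₑ ^ p.toReal with hN
  have hNtop : N ≠ ∞ :=
    ((eLpNorm_lt_top_iff_lintegral_rpow_enorm_lt_top hp0 hp'.ne).1 hf.2).ne
  have hfN : eLpNorm f p volume = N ^ (1 / p.toReal) :=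
    eLpNorm_eq_lintegral_rpow_enorm_toReal hp0 hp'.ne
  by_cases hN0 : N = 0
  · rw [hfN, hN0, ENNReal.zero_rpow_of_pos (by positivity)]; exact zero_le
  -- The extremiser in Hölder's inequality: `f * g` is the `p`-th power of `‖f‖`, and the norm of
  -- `g` in `L^q` is `N ^ (1 / q)`.
  let g : Space m → ℂ := fun x => ((‖f x‖ ^ (p.toReal - 2) : ℝ) : ℂ) * starRingEnd ℂ (f x)
  have hgm : AEStronglyMeasurable g volume := by
    have := hf.1.aemeasurable
    have h1 : AEMeasurable (fun x => ‖f x‖ ^ (p.toReal - 2)) volume := this.norm.pow_const _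
    exact ((Complex.measurable_ofReal.comp_aemeasurable h1).mul
      (Complex.continuous_conj.measurable.comp_aemeasurable this)).aestronglyMeasurable
  have hgn : ∀ x, ‖g x‖ = ‖f x‖ ^ (p.toReal - 1) := fun x => by
    simp only [g, norm_mul, Complex.norm_real, RCLike.norm_conj]
    rw [Real.norm_of_nonneg (by positivity)]
    rcases (norm_nonneg (f x)).eq_or_lt with h0 | h0
    · rw [← h0, Real.zero_rpow (by linarith : p.toReal - 1 ≠ 0), mul_zero]
    · rw [← Real.rpow_add_one h0.ne']; congr 1; ring
  have hfg : ∀ x, f x * g x = ((‖f x‖ ^ p.toReal : ℝ) : ℂ) := fun x => by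
    simp only [g]
    rw [mul_left_comm, Complex.mul_conj, Complex.normSq_eq_norm_sq, ← Complex.ofReal_mul]
    congr 1
    rcases (norm_nonneg (f x)).eq_or_lt with h0 | h0
    · rw [← h0, Real.zero_rpow (by linarith : p.toReal ≠ 0)]; simp
    · rw [← Real.rpow_natCast, ← Real.rpow_add h0]; congr 1; push_cast; ring
  have hgN : ∀ x, ‖g x‖ₑ ^ q.toReal = ‖f x‖ₑ ^ p.toReal := fun x => by
    rw [← ofReal_norm, hgn, ← ENNReal.ofReal_rpow_of_nonneg (norm_nonneg _) (by linarith),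
      ofReal_norm, ← ENNReal.rpow_mul, hconj.sub_one_mul_conj]
  have hgq : eLpNorm g q volume = N ^ (1 / q.toReal) := by
    rw [eLpNorm_eq_lintegral_rpow_enorm_toReal hq0 hqtop.ne]
    simp only [hgN, hN]
  have hgL : MemLp g q volume :=
    ⟨hgm, by rw [hgq]; exact (ENNReal.rpow_ne_top_of_nonneg (by positivity) hNtop).lt_top⟩
  have hI : ‖∫ x, f x * g x‖ₑ = N := by
    simp only [hfg]
    rw [integral_complex_ofReal, ← ofReal_norm, Complex.norm_real, Real.norm_of_nonneg
      (integral_nonneg fun x => by positivity), ofReal_integral_eq_lintegral_ofReal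
      (hf.integrable_norm_rpow hp0 hp'.ne) (Filter.Eventually.of_forall fun x => by positivity)]
    refine lintegral_congr fun x => ?_
    rw [← ENNReal.ofReal_rpow_of_nonneg (norm_nonneg _) (by linarith), ofReal_norm]
  have hmain := enorm_integral_mul_le hm hp hp' hq1 hqtop hC h hf
    ((h₁ f hf).trans_lt (ENNReal.mul_lt_top hC₁.lt_top hf.2)).ne hgL
  rw [hI, hgq, ← mul_assoc, mul_comm _ C] at hmain
  have hNq0 : N ^ (1 / q.toReal) ≠ 0 := by simp [hN0, hNtop]
  have hNqtop : N ^ (1 / q.toReal) ≠ ∞ := ENNReal.rpow_ne_top_of_nonneg (by positivity) hNtop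
  -- Cancels `N ^ (1 / q)`, legitimate since `N` is neither zero nor infinite; `1 / p + 1 / q = 1`
  -- leaves the norm of `f`.
  refine (ENNReal.mul_le_mul_iff_left hNq0 hNqtop).1 (le_of_eq_of_le ?_ hmain)
  rw [hfN, ← ENNReal.rpow_add _ _ hN0 hNtop, one_div, one_div, hconj.inv_add_inv_eq_one,
    ENNReal.rpow_one]

end Lower

/-! ### The twisted systems -/

section Twist

variable {m : ℕ}

/-- The shear `T₂` as an equivalence. -/
def shearLeft (m : ℕ) : Space m ≃ᵐ Space m where
  toFun := T₂
  invFun x := (x.1 + x.2, x.2)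
  left_inv x := by simp [T₂]
  right_inv x := by simp [T₂]
  measurable_toFun := by
    change Measurable fun x : Space m => (x.1 - x.2, x.2)
    fun_prop
  measurable_invFun := by
    change Measurable fun x : Space m => (x.1 + x.2, x.2)
    fun_prop

/-- The shear `T₃` as an equivalence. -/
def shearRight (m : ℕ) : Space m ≃ᵐ Space m where
  toFun := T₃
  invFun x := (x.1, x.2 + x.1)
  left_inv x := by simp [T₃]
  right_inv x := by simp [T₃]
  measurable_toFun := by
    change Measurable fun x : Space m => (x.1, x.2 - x.1)
    fun_prop
  measurable_invFun := by
    change Measurable fun x : Space m => (x.1, x.2 + x.1)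
    fun_prop

theorem measurePreserving_shearLeft : MeasurePreserving (shearLeft m) volume volume :=
  measurePreserving_sub_prod volume volume

theorem measurePreserving_shearRight : MeasurePreserving (shearRight m) volume volume := by
  have h := measurePreserving_prod_neg_add (volume : Measure (Fin m → ℝ)) volume
  have e : ⇑(shearRight m) = fun z => (z.1, -z.1 + z.2) := by
    ext x : 1
    change (x.1, x.2 - x.1) = _
    rw [sub_eq_neg_add]
  rw [e]
  exact h

/-- The change of variables moves the map from the Haar functions to `f` in each coefficient, while
the outer Haar factor is still evaluated at `e x`. -/
theorem squareFunction_comp (e : Space m ≃ᵐ Space m) (he : MeasurePreserving e volume volume)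
    (f : Space m → ℂ) :
    squareFunction (fun r x => B₁ r (e x)) f = squareFunction B₁ (f ∘ e.symm) ∘ e := by
  ext x
  unfold squareFunction
  simp only [Function.comp_apply]
  congr 2
  ext r
  rw [← he.integral_comp e.measurableEmbedding fun y => f (e.symm y) * (B₁ r y : ℂ)]
  simp

/-- Two-sided bounds for the square function pass to every measure preserving change of
variables. -/
theorem squareFunction_comp_bounds {p : ℝ≥0∞} {c C : ℝ≥0}
    (h : ∀ f : Space m → ℂ, MemLp f p volume → MemLp (squareFunction B₁ f) p volume ∧
      c * eLpNorm f p volume ≤ eLpNorm (squareFunction B₁ f) p volume ∧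
      eLpNorm (squareFunction B₁ f) p volume ≤ C * eLpNorm f p volume)
    (e : Space m ≃ᵐ Space m) (he : MeasurePreserving e volume volume) {f : Space m → ℂ}
    (hf : MemLp f p volume) :
    MemLp (squareFunction (fun r x => B₁ r (e x)) f) p volume ∧
      c * eLpNorm f p volume ≤ eLpNorm (squareFunction (fun r x => B₁ r (e x)) f) p volume ∧
      eLpNorm (squareFunction (fun r x => B₁ r (e x)) f) p volume ≤ C * eLpNorm f p volume := by
  have he' : MeasurePreserving e.symm volume volume := he.symm
  have hg := hf.comp_measurePreserving he'
  have h1 := h _ hg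
  rw [eLpNorm_comp_measurePreserving hf.1 he'] at h1
  rw [squareFunction_comp e he, eLpNorm_comp_measurePreserving h1.1.1 he]
  exact ⟨h1.1.comp_measurePreserving he, h1.2⟩

theorem squareFunction_B₁_bounds (hm : 1 ≤ m) {p : ℝ≥0∞} (hp : 1 < p) (hp' : p < ∞) :
    ∃ c C : ℝ≥0, 0 < c ∧ 0 < C ∧ ∀ f : Space m → ℂ, MemLp f p volume →
      MemLp (squareFunction B₁ f) p volume ∧
      c * eLpNorm f p volume ≤ eLpNorm (squareFunction B₁ f) p volume ∧
      eLpNorm (squareFunction B₁ f) p volume ≤ C * eLpNorm f p volume := by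
  obtain ⟨C, hC, h⟩ := eLpNorm_squareFunction_B₁_le m hp hp'
  obtain ⟨D, hD, h'⟩ := eLpNorm_le_squareFunction_B₁ hm hp hp'
  lift C to ℝ≥0 using hC
  lift D to ℝ≥0 using hD
  -- Adding one makes both constants strictly positive and the inverse finite, even if `C` or `D` is
  -- zero.
  refine ⟨(D + 1)⁻¹, C + 1, by positivity, by positivity, fun f hf => ⟨⟨?_, ?_⟩, ?_, ?_⟩⟩
  · exact (measurable_squareFunction_B₁ f).aestronglyMeasurable
  · exact (h f hf).trans_lt (ENNReal.mul_lt_top (by simp) hf.2)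
  · rw [ENNReal.coe_inv (by positivity), mul_comm, ← div_eq_mul_inv]
    refine ENNReal.div_le_of_le_mul ((h' f hf).trans ?_)
    rw [mul_comm]
    gcongr
    exact_mod_cast le_self_add
  · refine (h f hf).trans ?_
    gcongr
    exact_mod_cast le_self_add

end Twist

end TwistedHaar

theorem mainTheorem2 (m : ℕ) (hm : 1 ≤ m) (p : ℝ≥0∞) (hp1 : 1 < p) (hp : p < ∞) :
    ∃ c C : ℝ≥0, 0 < c ∧ 0 < C ∧
      ∀ (i : Fin 3) (f : TwistedHaar.Space m → ℂ), MemLp f p volume →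
        MemLp (TwistedHaar.S_d i f) p volume ∧
        c * eLpNorm f p volume ≤ eLpNorm (TwistedHaar.S_d i f) p volume ∧
        eLpNorm (TwistedHaar.S_d i f) p volume ≤ C * eLpNorm f p volume := by
  obtain ⟨c, C, hc, hC, h⟩ := TwistedHaar.squareFunction_B₁_bounds hm hp1 hp
  refine ⟨c, C, hc, hC, fun i f hf => ?_⟩
  fin_cases i
  · exact h f hf
  · exact TwistedHaar.squareFunction_comp_bounds h (TwistedHaar.shearLeft m)
      TwistedHaar.measurePreserving_shearLeft hf
  · exact TwistedHaar.squareFunction_comp_bounds h (TwistedHaar.shearRight m)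
      TwistedHaar.measurePreserving_shearRight hf
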